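/- Let $\zeta\ge 2$ and $d$ be natural numbers, let $\mathbb{S}^{\zeta-1}\subset\mathbb{R}^\zeta$ be the unit sphere and let $\mathbb{MS}(\zeta,d)=(\mathbb{S}^{\zeta-1})^d$ be the multisphere, with its uniform probability measure $\mu$; write $\mathbf{x}=(\mathbf{x}^{(1)},\dots,\mathbf{x}^{(d)})$ for its points. Let $\boldsymbol{k}:\mathbb{MS}(\zeta,d)\times\mathbb{MS}(\zeta,d)\to\mathbb{R}$ be a factorizable multi-dot product kernel, i.e. $\boldsymbol{k}(\mathbf{x},\mathbf{z})=\prod_{i=1}^d \boldsymbol{k}_i(\langle\mathbf{x}^{(i)},\mathbf{z}^{(i)}\rangle)$ for some functions $\boldsymbol{k}_i$, and suppose that it is given by a convergent multivariate power series $$\boldsymbol{k}(\mathbf{x},\mathbf{z})=\sum_{\mathbf{n}\in\mathbb{N}^d} b_{\mathbf{n}}\,\prod_{i=1}^d\langle\mathbf{x}^{(i)},\mathbf{z}^{(i)}\rangle^{n_i},\qquad b_{\mathbf{n}}\ge 0 .$$ Let $\mathcal{R}\subseteq\{1,\dots,d\}$ be its receptive field, i.e. the set of those $i$ for which there is $\mathbf{n}$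 with $n_i\ge1$ and $b_{\mathbf{n}}\ne0$ (so $b_{\mathbf n}=0$ if $n_i>0$ for some $i\notin\mathcal R$). Suppose that for some constant $c>0$ and some non-integer $\nu>1$ $$b_{\mathbf{n}}\sim c\prod_{i\in\mathcal{R},\,n_i>0} n_i^{-\nu}$$ as $n_i\to\infty$ for all $i\in\mathcal{R}$ jointly, with $n_i=0$ for $i\notin\mathcal{R}$; here $f\sim g$ means $f/g\to1$. A spherical harmonic of frequency $k$ is the restriction to $\mathbb{S}^{\zeta-1}$ of a homogeneous harmonic polynomial of degree $k$, and an SH-product of frequencies $\mathbf{k}\in\mathbb{N}^d$ is a function $\mathbf{x}\mapsto\prod_{i=1}^d Y_i(\mathbf{x}^{(i)})$ with each $Y_i$ a spherical harmonic of frequency $k_i$. Then: 1. The eigenfunctions of $\boldsymbol{k}$ with respect to the uniform measure are the SH-products: there are reals $\lambda_{\mathbf{k}}$, $\mathbf{k}\in\mathbb{N}^d$, such that every SH-product $Y$ of frequencies $\mathbf{k}$ satisfies $\int \boldsymbol{k}(\mathbf{x},\mathbf{z})Y(\mathbf{z})\,d\mu(\mathbf{z})=\lambda_{\mathbf{k}}Y(\mathbf{x})$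 for all $\mathbf{x}$; and if for each $k$ one chooses an orthonormal basis $(Y_{k,j})_j$ of the spherical harmonics of frequency $k$, then the SH-products $\prod_{i=1}^d Y_{k_i,j_i}(\mathbf{x}^{(i)})$ form an orthonormal basis of $L^2(\mu)$. 2. The eigenvalues satisfy $$\lambda_{\mathbf{k}}\sim\tilde c\prod_{i\in\mathcal{R},\,k_i>0}k_i^{-(\zeta+2\nu-3)}$$ with a constant $\tilde c>0$ as $k_i\to\infty$ for all $i\in\mathcal{R}$ jointly (and $k_i=0$ for $i\notin\mathcal R$). More generally, for every $S\subseteq\mathcal{R}$ the same holds, with a constant $\tilde c=\tilde c_S>0$, as $k_i\to\infty$ for all $i\in S$ jointly and $k_i=0$ for $i\notin S$. Moreover there are $c_1,c_2>0$ such that $c_1\prod_{i\in\mathcal{R},k_i>0}k_i^{-(\zeta+2\nu-3)}\le\lambda_{\mathbf{k}}\le c_2\prod_{i\in\mathcal{R},k_i>0}k_i^{-(\zeta+2\nu-3)}$ for all $\mathbf{k}$ with $k_i=0$ for $i\notin\mathcal{R}$. 3. $\lambda_{\mathbf{k}}=0$ whenever $k_i>0$ for some $i\notin\mathcal{R}$.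 -/

import Mathlib

open MeasureTheory
open scoped Asymptotics

noncomputable section

namespace Multisphere

/-- The unit sphere `𝕊^{ζ-1}` of `ℝ^ζ` (Euclidean norm). -/
abbrev Sph (ζ : ℕ) : Type := Metric.sphere (0 : EuclideanSpace ℝ (Fin ζ)) 1

/-- The multisphere: a product of `d` copies of `𝕊^{ζ-1}`; `x i` is the `i`-th pixel. -/
abbrev MS (ζ d : ℕ) : Type := Fin d → Sph ζ

/-- The uniform probability measure on the sphere: the normalized surface measure. -/
def unifSph (ζ : ℕ) : Measure (Sph ζ) :=
  ProbabilityTheory.cond (volume : Measure (EuclideanSpace ℝ (Fin ζ))).toSphere Set.univ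

instance (ζ : ℕ) : IsFiniteMeasure (unifSph ζ) := by
  unfold unifSph; infer_instance

/-- The uniform probability measure on the multisphere. -/
def unif (ζ d : ℕ) : Measure (MS ζ d) := Measure.pi fun _ => unifSph ζ

instance (ζ d : ℕ) : IsFiniteMeasure (unif ζ d) := by
  unfold unif; infer_instance

/-- The vector `t = (⟨x⁽¹⁾,z⁽¹⁾⟩, …, ⟨x⁽ᵈ⁾,z⁽ᵈ⁾⟩)` of inner products of corresponding pixels. -/
def dots {ζ d : ℕ} (x z : MS ζ d) : Fin d → ℝ :=
  fun i => inner ℝ (x i : EuclideanSpace ℝ (Fin ζ)) (z i : EuclideanSpace ℝ (Fin ζ))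

/-! ### Spherical harmonics -/

/-- The coordinate function `x ↦ x_j` on the sphere. -/
def coord (ζ : ℕ) (j : Fin ζ) : C(Sph ζ, ℝ) where
  toFun x := (x : EuclideanSpace ℝ (Fin ζ)) j
  continuous_toFun := by fun_prop

/-- Restriction of polynomials in `ζ` variables to the sphere. -/
def restrictSph (ζ : ℕ) : MvPolynomial (Fin ζ) ℝ →ₐ[ℝ] C(Sph ζ, ℝ) :=
  MvPolynomial.aeval (coord ζ)

/-- The Laplacian `∑ ∂²/∂x_j²` on polynomials in `ζ` variables. -/
def polyLaplacian (ζ : ℕ) : MvPolynomial (Fin ζ) ℝ →ₗ[ℝ] MvPolynomial (Fin ζ) ℝ :=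
  ∑ j, (MvPolynomial.pderiv j).toLinearMap ∘ₗ (MvPolynomial.pderiv j).toLinearMap

/-- The spherical harmonics of frequency `k` on `𝕊^{ζ-1}`: the restrictions to the sphere of the
homogeneous harmonic polynomials of degree `k`. -/
def sphHarm (ζ k : ℕ) : Submodule ℝ C(Sph ζ, ℝ) :=
  (MvPolynomial.homogeneousSubmodule (Fin ζ) ℝ k ⊓ LinearMap.ker (polyLaplacian ζ)).map
    (restrictSph ζ).toLinearMap

/-- `N(ζ,k)`, the number of (linearly independent) harmonics of frequency `k` on `𝕊^{ζ-1}`. -/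
def numHarm (ζ k : ℕ) : ℕ := Module.finrank ℝ (sphHarm ζ k)

/-- `Y k j`, `j = 1, …, N(ζ,k)`, are, for each frequency `k`, orthonormal spherical harmonics of
frequency `k` (hence a basis of the space of those, by the count). -/
def IsHarmonicSystem (ζ : ℕ) (Y : (k : ℕ) → Fin (numHarm ζ k) → C(Sph ζ, ℝ)) : Prop :=
  (∀ k j, Y k j ∈ sphHarm ζ k) ∧
    ∀ k j j', ∫ x, Y k j x * Y k j' x ∂(unifSph ζ) = if j = j' then 1 else 0

/-- The product function `x ↦ ∏ i, f_i (x⁽ⁱ⁾)` on the multisphere. It is an SH-product of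
frequencies `k` when each `f_i` is a spherical harmonic of frequency `k_i`. -/
def prodFun {ζ d : ℕ} (f : Fin d → C(Sph ζ, ℝ)) : C(MS ζ d, ℝ) where
  toFun x := ∏ i, f i (x i)
  continuous_toFun := by fun_prop

/-- The SH-product `Y_{k,j} = ∏ i, Y_{k_i j_i}(x⁽ⁱ⁾)`, indexed by the pair `(k, j)`. -/
def shProduct {ζ d : ℕ} (Y : (k : ℕ) → Fin (numHarm ζ k) → C(Sph ζ, ℝ))
    (p : Σ k : Fin d → ℕ, (i : Fin d) → Fin (numHarm ζ (k i))) : C(MS ζ d, ℝ) :=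
  prodFun fun i => Y (p.1 i) (p.2 i)

/-! ### Kernels -/

/-- `K` is a product of dot-product kernels of the individual pixels (in particular it depends on
`x`, `z` only through `dots x z`, so that it is multi-dot product). -/
def IsFactorizable {ζ d : ℕ} (K : MS ζ d → MS ζ d → ℝ) : Prop :=
  ∃ κ : Fin d → ℝ → ℝ, ∀ x z, K x z = ∏ i, κ i (dots x z i)

/-- `K(x,z) = ∑_{n ≥ 0} b_n t^n` with `t = dots x z`. -/
def HasPowerSeries {ζ d : ℕ} (K : MS ζ d → MS ζ d → ℝ) (b : (Fin d → ℕ) → ℝ) : Prop :=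
  ∀ x z, HasSum (fun n : Fin d → ℕ => b n * ∏ i, dots x z i ^ n i) (K x z)

open Classical in
/-- The receptive field: the indices `i` with `b_n ≠ 0` for some `n` with `n_i ≥ 1`. -/
def receptiveField {d : ℕ} (b : (Fin d → ℕ) → ℝ) : Finset (Fin d) :=
  Finset.univ.filter fun i => ∃ n : Fin d → ℕ, 1 ≤ n i ∧ b n ≠ 0

/-- The multi-index tends to infinity along the coordinate orthant of `S`: `n_i → ∞` for every
`i ∈ S` (jointly, in an arbitrary manner), while `n_i = 0` for every `i ∉ S`. -/
def atTopOn {d : ℕ} (S : Finset (Fin d)) : Filter (Fin d → ℕ) :=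
  (⨅ i ∈ S, Filter.comap (fun n : Fin d → ℕ => n i) Filter.atTop) ⊓
    Filter.principal {n | ∀ i ∉ S, n i = 0}

/-- `∏_{i ∈ R, n_i > 0} n_i^{-a}`. -/
def powProd {d : ℕ} (R : Finset (Fin d)) (a : ℝ) (n : Fin d → ℕ) : ℝ :=
  ∏ i ∈ R with 0 < n i, (n i : ℝ) ^ (-a)

end Multisphere

end

noncomputable section

namespace Multisphere

open Filter Topology Real Set

/-! ### Gauss' summation formula -/

/-! Everything reduces to one sphere. Comparing multivariate power series, `exists_factorization`
gives `b n = A * ∏ i, ρ i (n i)` with `A = ∏ i, κ i 1 > 0`, where `ρ i` are the nonnegative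
coefficients of `κ i / κ i 1`. Integrals of product functions factor, so the eigenvalue is `A * ∏ i,
eigenSum ζ (ρ i) (k i)`. Outside the receptive field `ρ i` is supported at `0`, which yields the
vanishing; inside it, `exists_isEquivalent_factor` separates the joint limit into power decay of
each `ρ i`.

On one sphere, `sphInt_linForm_pow_mul_eq` computes the eigenvalue `powCoeff` of `⟨x, z⟩ ^ (k + 2 *
j)`. Green's identity gives a recursion for the integrals of a power of a linear form times a
harmonic polynomial. It is derived from Gaussian integrals, where integration by parts has no
boundary terms, and carried to the sphere by polar coordinates.

For the asymptotics, set `s = ν - 1` and compare `ρ` with the reference coefficients `Γ(m - s) /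
m!`, which decay like `m ^ (-ν)`. Gauss' formula sums their eigenvalue series in closed form, a
constant times `Γ(k - s) / Γ(k + s + ζ - 1)`, of order `k ^ (-(ζ + 2ν - 3))`. Frequency `k` only
involves coefficients of index at least `k` with positive weights, so a relative error of the
coefficients passes to the sums (`eigenSum_isEquivalent`).

Completeness of the SH-products combines Stone–Weierstrass with the decomposition of polynomials on
the sphere into harmonics (`restrictSph_mem_iSup`). -/

lemma hasSum_Gamma_mul_pow_div_factorial {a u : ℝ} (ha : 0 < a) (hu : 0 ≤ u) (hu1 : u < 1) :
    HasSum (fun j : ℕ => Gamma (a + j) * u ^ j / j.factorial) (Gamma a * (1 - u) ^ (-a)) := by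
  -- Binomial series: write each `Γ(a + j)` as an Euler integral and sum the exponential series
  -- inside.
  have hInt : ∀ j : ℕ, ∫ x in Ioi (0 : ℝ), x ^ (a - 1) * exp (-x) * ((u * x) ^ j / j.factorial) =
      Gamma (a + j) * u ^ j / j.factorial := by
    intro j
    have h := Real.integral_rpow_mul_exp_neg_mul_Ioi (a := a + j) (r := 1) (by positivity) one_pos
    simp only [div_one, one_rpow, one_mul] at h
    rw [← h, mul_div_assoc, ← integral_mul_const]
    refine setIntegral_congr_fun measurableSet_Ioi fun x hx => ?_
    have hx : (0 : ℝ) < x := hx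
    have : x ^ (a + j - 1) = x ^ (a - 1) * x ^ j := by
      rw [← rpow_natCast x j, ← rpow_add hx]; congr 1; ring
    simp only [this]
    rw [mul_pow]; ring
  have hlim : ∀ x : ℝ, HasSum (fun j : ℕ => x ^ (a - 1) * exp (-x) * ((u * x) ^ j / j.factorial))
      (x ^ (a - 1) * exp (-((1 - u) * x))) := by
    intro x
    have h := (NormedSpace.expSeries_div_hasSum_exp (u * x)).mul_left (x ^ (a - 1) * exp (-x))
    rw [← Real.exp_eq_exp_ℝ, mul_assoc, ← Real.exp_add] at h
    convert! h using 3; ring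
  have htot : ∫ x in Ioi (0 : ℝ), x ^ (a - 1) * exp (-((1 - u) * x)) =
      Gamma a * (1 - u) ^ (-a) := by
    rw [Real.integral_rpow_mul_exp_neg_mul_Ioi ha (by linarith), one_div,
      inv_rpow (by linarith), rpow_neg (by linarith)]
    ring
  rw [← htot]
  simp only [← hInt]
  refine hasSum_integral_of_dominated_convergence
    (fun j x => x ^ (a - 1) * exp (-x) * ((u * x) ^ j / j.factorial)) ?_ ?_ ?_ ?_ ?_
  · exact fun j => Measurable.aestronglyMeasurable (by fun_prop)
  · intro j
    filter_upwards [ae_restrict_mem measurableSet_Ioi] with x hx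
    have hx : (0 : ℝ) < x := hx
    rw [Real.norm_of_nonneg (by positivity)]
  · exact ae_of_all _ fun x => (hlim x).summable
  · simp only [(hlim _).tsum_eq]
    -- Integrability comes for free: a non-integrable function has integral `0` by convention, but
    -- the value is known to be positive.
    by_contra hcon
    have := integral_undef hcon
    rw [htot] at this
    have h1 : 0 < 1 - u := by linarith
    have : 0 < Gamma a * (1 - u) ^ (-a) := by positivity
    linarith
  · exact ae_of_all _ hlim

/-- Read off from the fact that the beta density has total mass one. -/
lemma integral_rpow_mul_one_sub_rpow {a b : ℝ} (ha : 0 < a) (hb : 0 < b) :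
    ∫ x in Ioo (0 : ℝ) 1, x ^ (a - 1) * (1 - x) ^ (b - 1) =
      Gamma a * Gamma b / Gamma (a + b) := by
  have h := ProbabilityTheory.lintegral_betaPDF_eq_one ha hb
  have hB := ProbabilityTheory.beta_pos ha hb
  rw [ProbabilityTheory.lintegral_betaPDF, ← ENNReal.toReal_eq_one_iff,
    ← integral_eq_lintegral_of_nonneg_ae] at h
  · simp_rw [mul_assoc, integral_const_mul] at h
    rw [one_div, inv_mul_eq_one₀ hB.ne'] at h
    exact h.symm
  · refine ae_restrict_of_forall_mem measurableSet_Ioo fun x hx => ?_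
    have h1 := hx.1
    have h2 : 0 < 1 - x := by linarith [hx.2]
    simp only [Pi.zero_apply]
    positivity
  · exact Measurable.aestronglyMeasurable (by fun_prop)

/-- Gauss' summation formula for the hypergeometric series at `1`. -/
theorem hasSum_gauss {a b c : ℝ} (ha : 0 < a) (hb : 0 < b) (hc : a + b < c) :
    HasSum (fun j : ℕ => Gamma (a + j) * Gamma (b + j) / (j.factorial * Gamma (c + j)))
      (Gamma a * Gamma b * Gamma (c - a - b) / (Gamma (c - a) * Gamma (c - b))) := by
  have hcb : 0 < c - b := by linarith
  have hcab : 0 < c - a - b := by linarith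
  have hca : 0 < c - a := by linarith
  have hG : 0 < Gamma (c - b) := Gamma_pos_of_pos hcb
  -- Euler's argument: `Γ(b + j) / Γ(c + j)` is a beta integral up to the factor `Γ(c - b)`; summing
  -- the binomial series under it leaves another beta integral.
  have hInt : ∀ j : ℕ, ∫ u in Ioo (0 : ℝ) 1,
      (u ^ (b - 1) * (1 - u) ^ (c - b - 1)) * (Gamma (a + j) * u ^ j / j.factorial) =
      Gamma (c - b) * (Gamma (a + j) * Gamma (b + j) / (j.factorial * Gamma (c + j))) := by
    intro j
    have h := integral_rpow_mul_one_sub_rpow (a := b + j) (b := c - b) (by positivity) hcb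
    have h2 : ∫ u in Ioo (0 : ℝ) 1,
      (u ^ (b - 1) * (1 - u) ^ (c - b - 1)) * (Gamma (a + j) * u ^ j / j.factorial) =
        ∫ u in Ioo (0 : ℝ) 1, Gamma (a + j) / j.factorial *
          (u ^ (b + j - 1) * (1 - u) ^ (c - b - 1)) := by
      refine setIntegral_congr_fun measurableSet_Ioo fun x hx => ?_
      have : x ^ (b + j - 1) = x ^ (b - 1) * x ^ j := by
        rw [← rpow_natCast x j, ← rpow_add hx.1]; congr 1; ring
      simp only [this]
      ring
    rw [h2, integral_const_mul, h, show b + j + (c - b) = c + j by ring]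
    ring
  have hlim : ∀ u ∈ Ioo (0 : ℝ) 1, HasSum (fun j : ℕ =>
      (u ^ (b - 1) * (1 - u) ^ (c - b - 1)) * (Gamma (a + j) * u ^ j / j.factorial))
      (Gamma a * (u ^ (b - 1) * (1 - u) ^ (c - a - b - 1))) := by
    intro u hu
    have h := (hasSum_Gamma_mul_pow_div_factorial ha hu.1.le hu.2).mul_left
      (u ^ (b - 1) * (1 - u) ^ (c - b - 1))
    convert! h using 1
    rw [show c - a - b - 1 = c - b - 1 + -a by ring, rpow_add (by linarith [hu.2])]
    ring
  have htot : ∫ u in Ioo (0 : ℝ) 1, Gamma a * (u ^ (b - 1) * (1 - u) ^ (c - a - b - 1)) =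
      Gamma (c - b) * (Gamma a * Gamma b * Gamma (c - a - b) / (Gamma (c - a) * Gamma (c - b))) := by
    rw [integral_const_mul, integral_rpow_mul_one_sub_rpow hb hcab,
      show b + (c - a - b) = c - a by ring]
    field_simp
  have hmain : HasSum (fun j : ℕ =>
      Gamma (c - b) * (Gamma (a + j) * Gamma (b + j) / (j.factorial * Gamma (c + j))))
      (Gamma (c - b) * (Gamma a * Gamma b * Gamma (c - a - b) / (Gamma (c - a) * Gamma (c - b)))) := by
    rw [← htot]
    simp only [← hInt]
    refine hasSum_integral_of_dominated_convergence
      (fun j u => (u ^ (b - 1) * (1 - u) ^ (c - b - 1)) * (Gamma (a + j) * u ^ j / j.factorial))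
      ?_ ?_ ?_ ?_ ?_
    · exact fun j => Measurable.aestronglyMeasurable (by fun_prop)
    · intro j
      filter_upwards [ae_restrict_mem measurableSet_Ioo] with u hu
      have h1 := hu.1
      have h2 : 0 < 1 - u := by linarith [hu.2]
      rw [Real.norm_of_nonneg (by positivity)]
    · filter_upwards [ae_restrict_mem measurableSet_Ioo] with u hu using (hlim u hu).summable
    · have : Integrable (fun u : ℝ => Gamma a * (u ^ (b - 1) * (1 - u) ^ (c - a - b - 1)))
          (volume.restrict (Ioo 0 1)) := by
        by_contra hcon
        have := integral_undef hcon
        rw [htot] at this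
        have : 0 < Gamma (c - b) *
          (Gamma a * Gamma b * Gamma (c - a - b) / (Gamma (c - a) * Gamma (c - b))) := by positivity
        linarith
      refine this.congr ?_
      filter_upwards [ae_restrict_mem measurableSet_Ioo] with u hu using (hlim u hu).tsum_eq.symm
    · filter_upwards [ae_restrict_mem measurableSet_Ioo] with u hu using hlim u hu
  have := hmain.mul_left (Gamma (c - b))⁻¹
  simpa only [inv_mul_cancel_left₀ hG.ne'] using this

/-! ### The coefficients of the power kernels and their sums -/

/-- The eigenvalue of the kernel `⟨x, z⟩ ^ (k + 2 * j)` on the spherical harmonics of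
frequency `k` on `𝕊^{ζ-1}`. -/
def powCoeff (ζ k j : ℕ) : ℝ :=
  Gamma (ζ / 2) * (k + 2 * j).factorial /
    (2 ^ (k + 2 * j) * j.factorial * Gamma (k + j + ζ / 2))

/-- The eigenvalue of the kernel `∑ ρ_m ⟨x, z⟩ ^ m` on the spherical harmonics of frequency `k`. -/
def eigenSum (ζ : ℕ) (ρ : ℕ → ℝ) (k : ℕ) : ℝ := ∑' j, ρ (k + 2 * j) * powCoeff ζ k j

lemma powCoeff_pos {ζ : ℕ} (hζ : 0 < ζ) (k j : ℕ) : 0 < powCoeff ζ k j := by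
  unfold powCoeff; positivity

lemma Gamma_mul_factorial_le {x : ℝ} (hx : 1 ≤ x) (n : ℕ) :
    Gamma x * n.factorial ≤ Gamma (n + x) := by
  induction n with
  | zero => simp
  | succ n ih =>
    have : ((n + 1 : ℕ) : ℝ) + x = (n + x) + 1 := by push_cast; ring
    rw [this, Gamma_add_one (by positivity), Nat.factorial_succ]
    have h0 : 0 ≤ Gamma (n + x) := (Gamma_pos_of_pos (by positivity)).le
    push_cast
    calc Gamma x * ((n + 1) * n.factorial) = (n + 1) * (Gamma x * n.factorial) := by ring
      _ ≤ (n + x) * Gamma (n + x) := by gcongr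

/-- Split `(k + 2j)!` as `C(k + 2j, j) j! (k + j)!` and bound the binomial coefficient by `2 ^ (k +
2j)`. This makes the eigenvalue series converge. -/
lemma powCoeff_le_one {ζ : ℕ} (hζ : 2 ≤ ζ) (k j : ℕ) : powCoeff ζ k j ≤ 1 := by
  have hx : (1 : ℝ) ≤ ζ / 2 := by
    rw [le_div_iff₀ two_pos]; norm_num; exact_mod_cast hζ
  have h := Gamma_mul_factorial_le hx (k + j)
  push_cast at h
  have hpos : 0 < Gamma ((k : ℝ) + j + ζ / 2) := Gamma_pos_of_pos (by positivity)
  have hG : 0 < Gamma ((ζ : ℝ) / 2) := Gamma_pos_of_pos (by positivity)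
  unfold powCoeff
  rw [div_le_one (by positivity)]
  have hch : (k + 2 * j).choose j * j.factorial * (k + j).factorial = (k + 2 * j).factorial := by
    have := Nat.choose_mul_factorial_mul_factorial (show j ≤ k + 2 * j by omega)
    rwa [show k + 2 * j - j = k + j by omega] at this
  have h2 : ((k + 2 * j).choose j : ℝ) ≤ 2 ^ (k + 2 * j) := by
    exact_mod_cast Nat.choose_le_two_pow _ _
  rw [← hch]
  push_cast
  calc Gamma (ζ / 2) * ((k + 2 * j).choose j * j.factorial * (k + j).factorial)
      = ((k + 2 * j).choose j * j.factorial) * (Gamma (ζ / 2) * (k + j).factorial) := by ring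
    _ ≤ (2 ^ (k + 2 * j) * j.factorial) * Gamma (k + j + ζ / 2) := by gcongr

lemma summable_mul_powCoeff {ζ : ℕ} (hζ : 2 ≤ ζ) {ρ : ℕ → ℝ} (h0 : ∀ m, 0 ≤ ρ m)
    (hρ : Summable ρ) (k : ℕ) : Summable fun j => ρ (k + 2 * j) * powCoeff ζ k j := by
  have hinj : Function.Injective fun j : ℕ => k + 2 * j := fun i j h => by simpa using h
  refine Summable.of_nonneg_of_le
    (fun j => mul_nonneg (h0 _) (powCoeff_pos (by omega) k j).le) (fun j => ?_)
    (hρ.comp_injective hinj)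
  exact mul_le_of_le_one_right (h0 _) (powCoeff_le_one hζ k j)

/-- The factorial in `powCoeff` cancels the one in the reference coefficient, and the duplication
formula splits `Γ(k + 2j - s)` into `Γ(a + j) Γ(a + 1/2 + j)` with `a = (k - s) / 2`. What remains
is Gauss' series with `c = k + ζ / 2`. -/
lemma hasSum_eigenSum_reference {ζ : ℕ} (hζ : 2 ≤ ζ) {s : ℝ} (hs : 0 < s) {k : ℕ} (hk : s < k) :
    HasSum (fun j => Gamma ((k + 2 * j : ℕ) - s) / (k + 2 * j).factorial * powCoeff ζ k j)
      (Gamma (ζ / 2) * 2 ^ ((ζ : ℝ) + s - 2) / √π * Gamma (ζ / 2 + s - 1 / 2) *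
        (Gamma (k - s) / Gamma (k + s + ζ - 1))) := by
  have hζ' : (2 : ℝ) ≤ ζ := by exact_mod_cast hζ
  set a : ℝ := (k - s) / 2 with ha_def
  have ha : 0 < a := by rw [ha_def]; linarith
  have h := (hasSum_gauss (a := a) (b := a + 1 / 2) (c := k + ζ / 2) ha (by linarith)
    (by rw [ha_def]; linarith)).mul_left (Gamma (ζ / 2) * 2 ^ (-s - 1) / √π)
  have hπ : 0 < √π := by positivity
  convert! h using 1
  · funext j
    have hd := Real.Gamma_mul_Gamma_add_half (a + j)
    rw [show a + 1 / 2 + (j : ℝ) = a + j + 1 / 2 by ring, hd]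
    have e1 : (2 : ℝ) * (a + j) = (k + 2 * j : ℕ) - s := by rw [ha_def]; push_cast; ring
    have e2 : (2 : ℝ) ^ (-s - 1) * 2 ^ (1 - ((k + 2 * j : ℕ) - s)) = (2 ^ (k + 2 * j))⁻¹ := by
      rw [← rpow_add two_pos, ← rpow_natCast, ← rpow_neg two_pos.le]; congr 1; ring
    rw [e1, powCoeff, show (k : ℝ) + ζ / 2 + j = k + j + ζ / 2 by ring]
    have hf : ((k + 2 * j).factorial : ℝ) ≠ 0 := by positivity
    have hG : Gamma ((k : ℝ) + j + ζ / 2) ≠ 0 := (Gamma_pos_of_pos (by positivity)).ne'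
    have hj : (j.factorial : ℝ) ≠ 0 := by positivity
    calc _ = Gamma (ζ / 2) * Gamma ((k + 2 * j : ℕ) - s) * (2 ^ (k + 2 * j))⁻¹ /
          (j.factorial * Gamma (k + j + ζ / 2)) := by field_simp
      _ = _ := by rw [← e2]; field_simp
  · have hd1 := Real.Gamma_mul_Gamma_add_half a
    have hd2 := Real.Gamma_mul_Gamma_add_half ((k + s + ζ - 1) / 2)
    have e1 : (k : ℝ) + ζ / 2 - a = (k + s + ζ - 1) / 2 + 1 / 2 := by rw [ha_def]; ring
    have e2 : (k : ℝ) + ζ / 2 - (a + 1 / 2) = (k + s + ζ - 1) / 2 := by rw [ha_def]; ring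
    have e3 : (k : ℝ) + ζ / 2 - a - (a + 1 / 2) = ζ / 2 + s - 1 / 2 := by rw [ha_def]; ring
    rw [e3, e1, e2, mul_comm (Gamma ((k + s + ζ - 1) / 2 + 1 / 2)), hd1, hd2,
      show 2 * a = k - s by rw [ha_def]; ring,
      show 2 * ((k + s + ζ - 1 : ℝ) / 2) = k + s + ζ - 1 by ring]
    have hG : Gamma (k + s + ζ - 1) ≠ 0 := (Gamma_pos_of_pos (by linarith)).ne'
    have e4 : (2 : ℝ) ^ ((ζ : ℝ) + s - 2) * 2 ^ (1 - (k + s + ζ - 1 : ℝ)) =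
        2 ^ (-s - 1) * 2 ^ (1 - (k - s) : ℝ) := by
      rw [← rpow_add two_pos, ← rpow_add two_pos]; congr 1; ring
    have hp : (2 : ℝ) ^ (1 - (k + s + ζ - 1 : ℝ)) ≠ 0 := (rpow_pos_of_pos two_pos _).ne'
    rw [div_mul_eq_mul_div, div_mul_eq_mul_div, div_mul_eq_mul_div, div_left_inj' hπ.ne']
    field_simp
    linear_combination Gamma ((ζ + 2 * s - 1) / 2) * Gamma (k - s) * e4

/-! ### Gamma asymptotics and eigenvalue decay on one sphere -/

lemma isEquivalent_Gamma_natCast_add {x : ℝ} (hx : ∀ m : ℕ, x ≠ -m) :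
    (fun n : ℕ => Gamma (n + x)) ~[atTop] fun n : ℕ => (n : ℝ) ^ (x - 1) * n.factorial := by
  have hG : Gamma x ≠ 0 := Gamma_ne_zero hx
  have hprod : ∀ n : ℕ, (∏ j ∈ Finset.range n, (x + j)) * Gamma x = Gamma (n + x) := by
    intro n
    induction n with
    | zero => simp
    | succ n ih =>
      have hne : (n : ℝ) + x ≠ 0 := fun h => hx n (by linarith)
      rw [Finset.prod_range_succ, mul_right_comm, ih, show ((n + 1 : ℕ) : ℝ) + x = n + x + 1 by
        push_cast; ring, Gamma_add_one hne]
      ring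
  have hne' : ∀ n : ℕ, Gamma (n + x) ≠ 0 := fun n => Gamma_ne_zero fun m h => hx (m + n) (by
    push_cast; linarith)
  -- Euler's limit formula; it also covers the negative non-integer `x = -s` needed later. The
  -- factor `(n + x) / n` in `h2` shifts `Γ(n + 1 + x)` back to `Γ(n + x)`.
  have h1 := (Real.GammaSeq_tendsto_Gamma x).const_mul (Gamma x)⁻¹
  rw [inv_mul_cancel₀ hG] at h1
  have h2 : Tendsto (fun n : ℕ => ((n : ℝ) + x) / n) atTop (𝓝 1) := by
    have : Tendsto (fun n : ℕ => 1 + x / (n : ℝ)) atTop (𝓝 (1 + 0)) :=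
      tendsto_const_nhds.add (tendsto_const_div_atTop_nhds_zero_nat x)
    rw [add_zero] at this
    refine this.congr' ?_
    filter_upwards [eventually_gt_atTop 0] with n hn
    field_simp
  have h3 := h1.mul h2
  rw [mul_one] at h3
  refine Asymptotics.IsEquivalent.symm ?_
  refine (Asymptotics.isEquivalent_iff_tendsto_one (Eventually.of_forall hne')).2 ?_
  refine h3.congr' ?_
  filter_upwards [eventually_gt_atTop 0] with n hn
  have hnx : (n : ℝ) + x ≠ 0 := fun h => hx n (by linarith)
  have hn' : (0 : ℝ) < n := by exact_mod_cast hn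
  have hp := hprod (n + 1)
  rw [show ((n + 1 : ℕ) : ℝ) + x = n + x + 1 by push_cast; ring, Gamma_add_one hnx] at hp
  have hP : ∏ j ∈ Finset.range (n + 1), (x + j) ≠ 0 := fun h => by
    rw [h, zero_mul] at hp; exact mul_ne_zero hnx (hne' n) hp.symm
  simp only [Pi.div_apply, GammaSeq]
  rw [rpow_sub_one hn'.ne']
  have hGn := hne' n
  field_simp
  linear_combination -hp

/-- The decay of the coefficients of a dot product kernel determines that of its eigenvalues. -/
theorem eigenSum_isEquivalent {ζ : ℕ} (hζ : 2 ≤ ζ) {ν : ℝ} (hν : 1 < ν) (hν' : ∀ m : ℤ, ν ≠ m)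
    {ρ : ℕ → ℝ} (h0 : ∀ m, 0 ≤ ρ m) (hρ : Summable ρ) {c : ℝ} (hc : 0 < c)
    (hasymp : ρ ~[atTop] fun m : ℕ => c * (m : ℝ) ^ (-ν)) :
    ∃ c' : ℝ, 0 < c' ∧ eigenSum ζ ρ ~[atTop] fun k : ℕ => c' * (k : ℝ) ^ (-(ζ + 2 * ν - 3)) := by
  set s : ℝ := ν - 1 with hs_def
  have hs : 0 < s := by linarith
  have hζ' : (2 : ℝ) ≤ ζ := by exact_mod_cast hζ
  -- Non-integrality of `ν` enters here: it keeps `-s` away from the poles of Gamma.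
  have hx : ∀ m : ℕ, -s ≠ -m := fun m h => hν' (m + 1) (by push_cast; linarith)
  set r : ℕ → ℝ := fun m => Gamma (m - s) / m.factorial with hr_def
  set D : ℝ := Gamma (ζ / 2) * 2 ^ ((ζ : ℝ) + s - 2) / √π * Gamma (ζ / 2 + s - 1 / 2) with hD_def
  have hD : 0 < D := by
    have : 0 < (ζ : ℝ) / 2 + s - 1 / 2 := by linarith
    have : 0 < (ζ : ℝ) / 2 := by linarith
    rw [hD_def]; positivity
  have hr : r ~[atTop] fun m : ℕ => (m : ℝ) ^ (-ν) := by
    have h := (isEquivalent_Gamma_natCast_add hx).div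
      (Asymptotics.IsEquivalent.refl (u := fun n : ℕ => (n.factorial : ℝ)) (l := atTop))
    refine (h.congr_left ?_).congr_right ?_
    · exact Eventually.of_forall fun n => by simp [hr_def, sub_eq_add_neg]
    · refine Eventually.of_forall fun n => ?_
      simp only [Pi.div_apply]
      rw [mul_div_cancel_right₀ _ (by positivity), hs_def]
      congr 1; ring
  have hρr : ρ ~[atTop] fun m => c * r m :=
    hasymp.trans ((Asymptotics.IsEquivalent.refl (u := fun _ : ℕ => c)).mul hr).symm
  have hlit : (ρ - fun m => c * r m) =o[atTop] r :=
    hρr.isLittleO.trans_isBigO (Asymptotics.isBigO_const_mul_self c r atTop)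
  have href : (fun k : ℕ => D * (Gamma (k - s) / Gamma (k + s + ζ - 1))) ~[atTop]
      fun k : ℕ => D * (k : ℝ) ^ (-(ζ + 2 * ν - 3)) := by
    have h1 := isEquivalent_Gamma_natCast_add hx
    have h2 := isEquivalent_Gamma_natCast_add (x := s + ζ - 1) (fun m h => by
      have : (0 : ℝ) ≤ m := m.cast_nonneg
      linarith)
    refine (Asymptotics.IsEquivalent.refl (u := fun _ : ℕ => D)).mul
      (((h1.div h2).congr_left ?_).congr_right ?_)
    · refine Eventually.of_forall fun n => ?_
      simp only [Pi.div_apply, ← sub_eq_add_neg]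
      congr 2; ring
    · filter_upwards [eventually_gt_atTop 0] with n hn
      have hn' : (0 : ℝ) < n := by exact_mod_cast hn
      simp only [Pi.div_apply]
      rw [mul_div_mul_right _ _ (by positivity), ← rpow_sub hn']
      congr 1; rw [hs_def]; ring
  refine ⟨c * D, by positivity, ?_⟩
  have hmain : eigenSum ζ ρ ~[atTop]
      fun k : ℕ => c * (D * (Gamma (k - s) / Gamma (k + s + ζ - 1))) := by
    have key : (eigenSum ζ ρ - fun k : ℕ => c * (D * (Gamma (k - s) / Gamma (k + s + ζ - 1))))
        =o[atTop] fun k : ℕ => D * (Gamma (k - s) / Gamma (k + s + ζ - 1)) := by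
      rw [Asymptotics.isLittleO_iff] at hlit ⊢
      intro ε hε
      -- Once `k ≥ N`, every index `k + 2j` is in the range of the estimate, so it can be summed
      -- termwise; `k > s` makes the reference terms nonnegative and their sum known.
      obtain ⟨N, hN⟩ := eventually_atTop.1 (hlit hε)
      obtain ⟨N', hN'⟩ := exists_nat_gt s
      filter_upwards [eventually_ge_atTop (max N N')] with k hk
      have hk1 : N ≤ k := (le_max_left _ _).trans hk
      have hk2 : s < k := hN'.trans_le (by exact_mod_cast (le_max_right _ _).trans hk)
      have hrefsum := hasSum_eigenSum_reference hζ hs hk2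
      rw [← hD_def] at hrefsum
      have hsum := (summable_mul_powCoeff hζ h0 hρ k).hasSum
      have hdiff := hsum.sub (hrefsum.mul_left c)
      have hrpos : ∀ j, 0 ≤ r (k + 2 * j) := fun j => by
        have : s < ((k + 2 * j : ℕ) : ℝ) := by push_cast; nlinarith [(j.cast_nonneg : (0 : ℝ) ≤ j)]
        have := Gamma_pos_of_pos (sub_pos.2 this)
        rw [hr_def]; positivity
      have hterm : ∀ j, |ρ (k + 2 * j) * powCoeff ζ k j - c * (r (k + 2 * j) * powCoeff ζ k j)| ≤
          ε * (r (k + 2 * j) * powCoeff ζ k j) := fun j => by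
        have hβ := powCoeff_pos (show 0 < ζ by omega) k j
        have h := hN (k + 2 * j) (by omega)
        rw [Pi.sub_apply, Real.norm_eq_abs, Real.norm_of_nonneg (hrpos j)] at h
        rw [← mul_assoc, ← sub_mul, abs_mul, abs_of_pos hβ, ← mul_assoc]
        exact mul_le_mul_of_nonneg_right h hβ.le
      have hup := hasSum_le (fun j => (abs_le.1 (hterm j)).2) hdiff (hrefsum.mul_left ε)
      have hlo := hasSum_le (fun j => by have := (abs_le.1 (hterm j)).1; rwa [← mul_neg] at this)
        (hrefsum.neg.mul_left ε) hdiff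
      rw [Pi.sub_apply, Real.norm_eq_abs]
      refine (abs_le.2 ⟨?_, hup⟩).trans (mul_le_mul_of_nonneg_left (le_abs_self _) hε.le)
      rw [← mul_neg]; exact hlo
    exact key.trans_isBigO (Asymptotics.isBigO_self_const_mul hc.ne' _ _)
  refine (hmain.trans ((Asymptotics.IsEquivalent.refl (u := fun _ : ℕ => c)).mul href)).congr_right ?_
  exact Eventually.of_forall fun k => by simp only [Pi.mul_apply]; ring

/-- The series at any frequency reaches indices where `ρ` is positive. This handles small `k`, about
which the asymptotics say nothing. -/
lemma eigenSum_pos {ζ : ℕ} (hζ : 2 ≤ ζ) {ρ : ℕ → ℝ} (h0 : ∀ m, 0 ≤ ρ m) (hρ : Summable ρ)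
    (hev : ∀ᶠ m in atTop, 0 < ρ m) (k : ℕ) : 0 < eigenSum ζ ρ k := by
  obtain ⟨N, hN⟩ := eventually_atTop.1 hev
  have hβ := fun j => powCoeff_pos (show 0 < ζ by omega) k j
  exact (summable_mul_powCoeff hζ h0 hρ k).tsum_pos (fun j => mul_nonneg (h0 _) (hβ j).le) N
    (mul_pos (hN _ (by omega)) (hβ N))

/-- The case of a pixel outside the receptive field: a constant kernel only sees frequency `0`. -/
lemma eigenSum_of_const {ζ : ℕ} (hζ : 2 ≤ ζ) {ρ : ℕ → ℝ} (hρ : ∀ m, 0 < m → ρ m = 0)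
    (k : ℕ) : eigenSum ζ ρ k = if k = 0 then ρ 0 else 0 := by
  unfold eigenSum
  rw [tsum_eq_single 0 fun j hj => by rw [hρ _ (by omega), zero_mul]]
  split_ifs with hk
  · subst hk
    have : Gamma ((ζ : ℝ) / 2) ≠ 0 := (Gamma_pos_of_pos (by positivity)).ne'
    simp [powCoeff, this]
  · simp [hρ k (by omega)]

/-- Two-sided bounds for a positive sequence with power decay. -/
lemma exists_bounds_of_isEquivalent {u : ℕ → ℝ} (hu : ∀ k, 0 < u k) {c a : ℝ} (hc : 0 < c)
    (h : u ~[atTop] fun k : ℕ => c * (k : ℝ) ^ (-a)) :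
    ∃ c₁ c₂ : ℝ, 0 < c₁ ∧ 0 < c₂ ∧ ∀ k : ℕ,
      c₁ * (if 0 < k then (k : ℝ) ^ (-a) else 1) ≤ u k ∧
        u k ≤ c₂ * (if 0 < k then (k : ℝ) ^ (-a) else 1) := by
  set w : ℕ → ℝ := fun k => if 0 < k then (k : ℝ) ^ (-a) else 1 with hw_def
  have hw : ∀ k, 0 < w k := fun k => by
    simp only [hw_def]; split_ifs with hk
    · have : (0 : ℝ) < k := by exact_mod_cast hk
      positivity
    · exact one_pos
  have hlim : Tendsto (fun k => u k / w k) atTop (𝓝 c) := by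
    have h1 : u ~[atTop] fun k => c * w k := h.congr_right (by
      filter_upwards [eventually_gt_atTop 0] with k hk
      simp [hw_def, hk])
    have h2 := ((Asymptotics.isEquivalent_iff_tendsto_one
      (Eventually.of_forall fun k => (mul_pos hc (hw k)).ne')).1 h1).const_mul c
    rw [mul_one] at h2
    refine h2.congr fun k => ?_
    have := (hw k).ne'
    simp only [Pi.div_apply]; field_simp
  have hpos : ∀ k, 0 < u k / w k := fun k => div_pos (hu k) (hw k)
  -- The ratio and its inverse both converge, hence are bounded; this absorbs the small indices,
  -- including `0`, where the weight is set to `1`.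
  obtain ⟨B, hB⟩ := hlim.bddAbove_range
  obtain ⟨B', hB'⟩ := (hlim.inv₀ hc.ne').bddAbove_range
  have hB0 : 0 < B := (hpos 0).trans_le (hB ⟨0, rfl⟩)
  have hB'0 : 0 < B' := (inv_pos.2 (hpos 0)).trans_le (hB' ⟨0, rfl⟩)
  refine ⟨B'⁻¹, B, inv_pos.2 hB'0, hB0, fun k => ⟨?_, ?_⟩⟩
  · rw [← le_div_iff₀ (hw k)]
    exact inv_le_of_inv_le₀ (hpos k) (hB' ⟨k, rfl⟩)
  · rw [← div_le_iff₀ (hw k)]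
    exact hB ⟨k, rfl⟩

end Multisphere

end

noncomputable section

namespace Multisphere

open Filter Topology Real Set MvPolynomial

/-! ### Gaussian integrals of polynomials -/

variable {ζ : ℕ}

lemma exists_abs_eval_le (p : MvPolynomial (Fin ζ) ℝ) :
    ∃ (C : ℝ) (n : ℕ), 0 ≤ C ∧
      ∀ z : EuclideanSpace ℝ (Fin ζ), |eval z.ofLp p| ≤ C * (1 + ‖z‖) ^ n := by
  induction p using MvPolynomial.induction_on with
  | C a => exact ⟨|a|, 0, abs_nonneg a, fun z => by simp⟩
  | add p q hp hq =>
    obtain ⟨C, n, hC, h⟩ := hp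
    obtain ⟨D, m, hD, h'⟩ := hq
    refine ⟨C + D, max n m, by positivity, fun z => ?_⟩
    have h1 : 1 ≤ 1 + ‖z‖ := by linarith [norm_nonneg z]
    rw [map_add, add_mul]
    refine (abs_add_le _ _).trans (add_le_add ((h z).trans ?_) ((h' z).trans ?_))
    · exact mul_le_mul_of_nonneg_left (pow_le_pow_right₀ h1 (le_max_left _ _)) hC
    · exact mul_le_mul_of_nonneg_left (pow_le_pow_right₀ h1 (le_max_right _ _)) hD
  | mul_X p j hp =>
    obtain ⟨C, n, hC, h⟩ := hp
    refine ⟨C, n + 1, hC, fun z => ?_⟩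
    have h1 : |z.ofLp j| ≤ 1 + ‖z‖ := by
      have := PiLp.norm_apply_le z j
      rw [Real.norm_eq_abs] at this
      linarith
    rw [map_mul, eval_X, abs_mul, pow_succ, ← mul_assoc]
    exact mul_le_mul (h z) h1 (abs_nonneg _) (by positivity)

lemma continuous_eval_ofLp (p : MvPolynomial (Fin ζ) ℝ) :
    Continuous fun z : EuclideanSpace ℝ (Fin ζ) => eval z.ofLp p :=
  (MvPolynomial.continuous_eval p).comp (PiLp.continuous_ofLp 2 _)

lemma integrable_exp_neg_sq_norm_div_four :
    Integrable fun z : EuclideanSpace ℝ (Fin ζ) => exp (-‖z‖ ^ 2 / 4) := by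
  have h := (GaussianFourier.integrable_cexp_neg_mul_sq_norm_add (V := EuclideanSpace ℝ (Fin ζ))
    (b := 1 / 4) (by norm_num) 0 0).norm
  refine h.congr (ae_of_all _ fun z => ?_)
  simp only [Complex.norm_exp]
  congr 1
  simp [← Complex.ofReal_pow]
  ring

lemma integrable_eval_mul_exp (p : MvPolynomial (Fin ζ) ℝ) :
    Integrable fun z : EuclideanSpace ℝ (Fin ζ) => eval z.ofLp p * exp (-‖z‖ ^ 2 / 2) := by
  obtain ⟨C, n, hC, h⟩ := exists_abs_eval_le p
  -- With `r = ‖z‖`, bound `(1 + r) ^ n` by `n! exp (1 + r)`; the constant `exp 2` comes from `1 + r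
  -- - r² / 2 ≤ 2 - r² / 4`, that is `(r - 2)² ≥ 0`.
  refine (integrable_exp_neg_sq_norm_div_four.const_mul (C * n.factorial * exp 2)).mono'
    ((continuous_eval_ofLp p).mul (by fun_prop)).aestronglyMeasurable (ae_of_all _ fun z => ?_)
  rw [norm_mul, Real.norm_eq_abs, Real.norm_of_nonneg (exp_pos _).le]
  have h1 : (1 + ‖z‖) ^ n ≤ n.factorial * exp (1 + ‖z‖) := by
    have := pow_div_factorial_le_exp (1 + ‖z‖) (by positivity) n
    rwa [div_le_iff₀' (by positivity)] at this
  calc |eval z.ofLp p| * exp (-‖z‖ ^ 2 / 2)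
      ≤ (C * (n.factorial * exp (1 + ‖z‖))) * exp (-‖z‖ ^ 2 / 2) := by
        gcongr; exact (h z).trans (by gcongr)
    _ = C * n.factorial * exp (1 + ‖z‖ + -‖z‖ ^ 2 / 2) := by rw [exp_add _ (-‖z‖ ^ 2 / 2)]; ring
    _ ≤ C * n.factorial * exp (2 + -‖z‖ ^ 2 / 4) := by
        refine mul_le_mul_of_nonneg_left (exp_le_exp.2 ?_) (by positivity)
        nlinarith [sq_nonneg (‖z‖ - 2)]
    _ = _ := by rw [exp_add]; ring

/-- The integral of a polynomial against the (unnormalized) standard Gaussian weight. -/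
def gaussInt : MvPolynomial (Fin ζ) ℝ →ₗ[ℝ] ℝ where
  toFun p := ∫ z : EuclideanSpace ℝ (Fin ζ), eval z.ofLp p * exp (-‖z‖ ^ 2 / 2)
  map_add' p q := by
    simp only [map_add, add_mul]
    exact integral_add (integrable_eval_mul_exp p) (integrable_eval_mul_exp q)
  map_smul' a p := by
    simp only [smul_eval, mul_assoc, integral_const_mul, RingHom.id_apply, smul_eq_mul]

lemma gaussInt_apply (p : MvPolynomial (Fin ζ) ℝ) :
    gaussInt p = ∫ z : EuclideanSpace ℝ (Fin ζ), eval z.ofLp p * exp (-‖z‖ ^ 2 / 2) := rfl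

lemma hasLineDerivAt_eval (p : MvPolynomial (Fin ζ) ℝ) (z : EuclideanSpace ℝ (Fin ζ))
    (j : Fin ζ) :
    HasLineDerivAt ℝ (fun z : EuclideanSpace ℝ (Fin ζ) => eval z.ofLp p)
      (eval z.ofLp (pderiv j p)) z (EuclideanSpace.single j 1) := by
  unfold HasLineDerivAt
  induction p using MvPolynomial.induction_on with
  | C a => simpa using hasDerivAt_const (0 : ℝ) a
  | add p q hp hq =>
    simp only [map_add]
    exact hp.add hq
  | mul_X p i hp =>
    have hX : HasDerivAt (fun t : ℝ => (z + t • EuclideanSpace.single j (1 : ℝ)).ofLp i)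
        (if i = j then 1 else 0) 0 := by
      have : (fun t : ℝ => (z + t • EuclideanSpace.single j (1 : ℝ)).ofLp i) =
          fun t : ℝ => z.ofLp i + t * (if i = j then 1 else 0) := by
        funext t; simp
      rw [this]
      simpa using ((hasDerivAt_id (0 : ℝ)).mul_const (if i = j then (1 : ℝ) else 0)).const_add
        (z.ofLp i)
    have h := hp.mul hX
    simp only [map_mul, eval_X]
    refine h.congr_deriv ?_
    rw [Derivation.leibniz, pderiv_X]
    by_cases hij : i = j
    · subst hij; simp; ring
    · simp [hij, mul_comm]

lemma hasLineDerivAt_exp_neg_sq_norm (z : EuclideanSpace ℝ (Fin ζ)) (j : Fin ζ) :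
    HasLineDerivAt ℝ (fun z : EuclideanSpace ℝ (Fin ζ) => exp (-‖z‖ ^ 2 / 2))
      (-(z.ofLp j * exp (-‖z‖ ^ 2 / 2))) z (EuclideanSpace.single j 1) := by
  unfold HasLineDerivAt
  have hq : (fun t : ℝ => exp (-‖z + t • EuclideanSpace.single j (1 : ℝ)‖ ^ 2 / 2)) =
      fun t : ℝ => exp (-(‖z‖ ^ 2 + 2 * (t * z.ofLp j) + t ^ 2) / 2) := by
    funext t
    rw [norm_add_sq_real, inner_smul_right, EuclideanSpace.inner_single_right, norm_smul]
    simp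
  rw [hq]
  have h : HasDerivAt (fun t : ℝ => -(‖z‖ ^ 2 + 2 * (t * z.ofLp j) + t ^ 2) / 2)
      (-(z.ofLp j)) 0 := by
    have h1 := ((((hasDerivAt_id (0 : ℝ)).mul_const (z.ofLp j)).const_mul 2).const_add
      (‖z‖ ^ 2)).add ((hasDerivAt_id (0 : ℝ)).pow 2)
    refine (h1.neg.div_const 2).congr_deriv ?_
    simp; ring
  refine h.exp.congr_deriv ?_
  simp; ring

/-- Gaussian integration by parts. -/
lemma gaussInt_pderiv (p : MvPolynomial (Fin ζ) ℝ) (j : Fin ζ) :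
    gaussInt (pderiv j p) = gaussInt (X j * p) := by
  have h := integral_bilinear_hasLineDerivAt_right_eq_neg_left_of_integrable
    (μ := (volume : Measure (EuclideanSpace ℝ (Fin ζ))))
    (f := fun z => eval z.ofLp p) (f' := fun z => eval z.ofLp (pderiv j p))
    (g := fun z => exp (-‖z‖ ^ 2 / 2)) (g' := fun z => -(z.ofLp j * exp (-‖z‖ ^ 2 / 2)))
    (v := EuclideanSpace.single j 1) (B := ContinuousLinearMap.mul ℝ ℝ)
    (integrable_eval_mul_exp _) ?_ (integrable_eval_mul_exp _)
    (fun z _ => hasLineDerivAt_eval p z j) (fun z _ => hasLineDerivAt_exp_neg_sq_norm z j)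
  · simp only [ContinuousLinearMap.mul_apply'] at h
    rw [gaussInt_apply, gaussInt_apply]
    rw [← neg_eq_iff_eq_neg] at h
    rw [← h, ← integral_neg]
    congr 1; funext z; simp; ring
  · refine (integrable_eval_mul_exp (X j * p)).neg.congr (ae_of_all _ fun z => ?_)
    simp; ring

/-! ### From Gaussian integrals to integrals over the sphere -/

/-- Integration over the sphere, as a functional on polynomials. -/
def sphInt (ζ : ℕ) : MvPolynomial (Fin ζ) ℝ →ₗ[ℝ] ℝ where
  toFun p := ∫ x, restrictSph ζ p x ∂(unifSph ζ)
  map_add' p q := by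
    simp only [map_add, ContinuousMap.add_apply]
    exact integral_add ((restrictSph ζ p).continuous.integrable_of_hasCompactSupport
      (HasCompactSupport.of_compactSpace _)) ((restrictSph ζ q).continuous.integrable_of_hasCompactSupport
      (HasCompactSupport.of_compactSpace _))
  map_smul' a p := by
    simp only [map_smul, ContinuousMap.smul_apply, integral_smul, RingHom.id_apply]

lemma restrictSph_apply (p : MvPolynomial (Fin ζ) ℝ) (x : Sph ζ) :
    restrictSph ζ p x = eval (x : EuclideanSpace ℝ (Fin ζ)).ofLp p := by
  induction p using MvPolynomial.induction_on with
  | C a => simp [restrictSph]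
  | add p q hp hq => simp [hp, hq]
  | mul_X p i hp => simp [hp]; left; simp [restrictSph, coord]

/-- The radial moments of the Gaussian weight. -/
def radialMoment (ζ n : ℕ) : ℝ := ∫ r in Ioi (0 : ℝ), r ^ (n + ζ - 1) * exp (-r ^ 2 / 2)

lemma radialMoment_eq (hζ : 0 < ζ) (n : ℕ) :
    radialMoment ζ n = (1 / 2) ^ (-((n + ζ : ℝ)) / 2) * (1 / 2) * Gamma ((n + ζ) / 2) := by
  have h := integral_rpow_mul_exp_neg_mul_rpow (p := 2) (q := n + ζ - 1) (b := 1 / 2) two_pos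
    (by have : (0 : ℝ) < ζ := by exact_mod_cast hζ
        have : (0 : ℝ) ≤ n := n.cast_nonneg
        linarith) (by norm_num)
  rw [sub_add_cancel] at h
  rw [← h, radialMoment]
  refine setIntegral_congr_fun measurableSet_Ioi fun r hr => ?_
  rw [← rpow_natCast r (n + ζ - 1), Nat.cast_sub (by omega)]
  push_cast
  congr 2
  rw [← rpow_natCast r 2]; push_cast; ring

lemma radialMoment_pos (hζ : 0 < ζ) (n : ℕ) : 0 < radialMoment ζ n := by
  rw [radialMoment_eq hζ]; positivity

/-- The Gamma recursion; this ratio of moments is the origin of the factor `n + ζ - 2` in Green's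
identity. -/
lemma radialMoment_add_two (hζ : 0 < ζ) (n : ℕ) :
    radialMoment ζ (n + 2) = (n + ζ) * radialMoment ζ n := by
  have hpos : (0 : ℝ) < (n + ζ) / 2 := by positivity
  rw [radialMoment_eq hζ, radialMoment_eq hζ, show (((n + 2 : ℕ) : ℝ) + ζ) / 2 = (n + ζ) / 2 + 1 by
    push_cast; ring, Gamma_add_one hpos.ne',
    show (-(((n + 2 : ℕ) : ℝ) + ζ)) / 2 = -(n + ζ) / 2 + -1 by push_cast; ring,
    rpow_add (by norm_num), rpow_neg_one]
  ring

lemma isProbabilityMeasure_unifSph (hζ : 0 < ζ) : IsProbabilityMeasure (unifSph ζ) := by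
  have : Nonempty (Fin ζ) := ⟨⟨0, hζ⟩⟩
  refine ProbabilityTheory.cond_isProbabilityMeasure ?_
  rw [Measure.measure_univ_ne_zero]
  exact Measure.toSphere_ne_zero _

lemma integral_toSphere (f : Sph ζ → ℝ) :
    ∫ x, f x ∂(volume : Measure (EuclideanSpace ℝ (Fin ζ))).toSphere =
      (volume : Measure (EuclideanSpace ℝ (Fin ζ))).toSphere.real univ * ∫ x, f x ∂(unifSph ζ) := by
  rcases eq_or_ne (volume : Measure (EuclideanSpace ℝ (Fin ζ))).toSphere 0 with h | h
  · simp [h]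
  · have h0 : (volume : Measure (EuclideanSpace ℝ (Fin ζ))).toSphere.real univ ≠ 0 := by
      rw [Measure.real, ENNReal.toReal_ne_zero]
      exact ⟨Measure.measure_univ_ne_zero.2 h, measure_ne_top _ _⟩
    simp only [unifSph, ProbabilityTheory.cond, Measure.restrict_univ, integral_smul_measure,
      smul_eq_mul, ENNReal.toReal_inv]
    rw [← mul_assoc, ← Measure.real, mul_inv_cancel₀ h0, one_mul]

lemma eval_mul_of_isHomogeneous {p : MvPolynomial (Fin ζ) ℝ} {n : ℕ} (hp : p.IsHomogeneous n)
    (a : ℝ) (v : Fin ζ → ℝ) : eval (fun i => a * v i) p = a ^ n * eval v p := by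
  rw [eval_eq', eval_eq', Finset.mul_sum]
  refine Finset.sum_congr rfl fun d hd => ?_
  have hn : ∑ i, d i = n := by
    have h := hp (mem_support_iff.1 hd)
    rw [Finsupp.weight_apply, Finsupp.sum_fintype _ _ (by simp)] at h
    simpa using h
  simp only [mul_pow, Finset.prod_mul_distrib, Finset.prod_pow_eq_pow_sum, hn]
  ring

/-- Polar coordinates for Gaussian integrals of homogeneous polynomials. -/
lemma gaussInt_eq_sphInt {p : MvPolynomial (Fin ζ) ℝ} {n : ℕ} (hp : p.IsHomogeneous n)
    (hζ : 0 < ζ) :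
    gaussInt p = (volume : Measure (EuclideanSpace ℝ (Fin ζ))).toSphere.real univ *
      radialMoment ζ n * sphInt ζ p := by
  set μ := (volume : Measure (EuclideanSpace ℝ (Fin ζ)))
  have : Nonempty (Fin ζ) := ⟨⟨0, hζ⟩⟩
  have hdim : Module.finrank ℝ (EuclideanSpace ℝ (Fin ζ)) = ζ := by simp
  calc gaussInt p
      = ∫ x : ({0}ᶜ : Set (EuclideanSpace ℝ (Fin ζ))), eval x.1.ofLp p * exp (-‖x.1‖ ^ 2 / 2)
          ∂(μ.comap (↑)) := by
        rw [integral_subtype_comap (measurableSet_singleton _).compl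
          fun x : EuclideanSpace ℝ (Fin ζ) => eval x.ofLp p * exp (-‖x‖ ^ 2 / 2),
          restrict_compl_singleton]
        rfl
    _ = ∫ x, (fun s : Sph ζ × Ioi (0 : ℝ) => restrictSph ζ p s.1 *
          ((s.2 : ℝ) ^ n * exp (-(s.2 : ℝ) ^ 2 / 2))) (homeomorphUnitSphereProd _ x)
          ∂(μ.comap (↑)) := by
        congr 1; funext x
        have hx : ‖x.1‖ ≠ 0 := norm_ne_zero_iff.2 x.2
        have he : eval x.1.ofLp p = ‖x.1‖ ^ n *
            eval (‖x.1‖⁻¹ • x.1).ofLp p := by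
          have h2 : x.1.ofLp = fun i => ‖x.1‖ * (‖x.1‖⁻¹ • x.1).ofLp i := by
            funext i; simp [hx]
          conv_lhs => rw [h2]
          exact eval_mul_of_isHomogeneous hp _ _
        simp only [restrictSph_apply, homeomorphUnitSphereProd_apply_snd_coe,
          homeomorphUnitSphereProd_apply_fst_coe]
        rw [he]; ring
    _ = ∫ s, restrictSph ζ p s.1 * ((s.2 : ℝ) ^ n * exp (-(s.2 : ℝ) ^ 2 / 2))
          ∂μ.toSphere.prod (.volumeIoiPow (Module.finrank ℝ (EuclideanSpace ℝ (Fin ζ)) - 1)) :=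
        μ.measurePreserving_homeomorphUnitSphereProd.integral_comp
          (Homeomorph.measurableEmbedding _) fun s : Sph ζ × Ioi (0 : ℝ) =>
            restrictSph ζ p s.1 * ((s.2 : ℝ) ^ n * exp (-(s.2 : ℝ) ^ 2 / 2))
    _ = (∫ x, restrictSph ζ p x ∂μ.toSphere) *
          ∫ r : Ioi (0 : ℝ), (r : ℝ) ^ n * exp (-(r : ℝ) ^ 2 / 2) ∂(.volumeIoiPow (ζ - 1)) := by
        rw [integral_prod_mul (fun x => restrictSph ζ p x)
          (fun r : Ioi (0 : ℝ) => (r : ℝ) ^ n * exp (-(r : ℝ) ^ 2 / 2)), hdim]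
    _ = _ := by
        rw [integral_toSphere, mul_right_comm]
        congr 2
        simp only [Measure.volumeIoiPow, ENNReal.ofReal]
        rw [integral_withDensity_eq_integral_smul,
          integral_subtype_comap measurableSet_Ioi
            fun a : ℝ => Real.toNNReal (a ^ (ζ - 1)) • (a ^ n * exp (-a ^ 2 / 2)), radialMoment]
        · refine setIntegral_congr_fun measurableSet_Ioi fun r hr => ?_
          rw [NNReal.smul_def, Real.coe_toNNReal _ (pow_nonneg (le_of_lt hr) _), smul_eq_mul,
            show n + ζ - 1 = (ζ - 1) + n by omega, pow_add]
          ring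
        · exact (measurable_subtype_coe.pow_const _).real_toNNReal

end Multisphere

end

noncomputable section

namespace Multisphere

open Filter Topology Real Set MvPolynomial

/-! ### Green's identity on the sphere -/

variable {ζ : ℕ}

lemma polyLaplacian_apply (p : MvPolynomial (Fin ζ) ℝ) :
    polyLaplacian ζ p = ∑ j, pderiv j (pderiv j p) := by
  simp [polyLaplacian]

/-- The commutator is a derivation that kills every variable. -/
lemma pderiv_pderiv_comm (i j : Fin ζ) (p : MvPolynomial (Fin ζ) ℝ) :
    pderiv i (pderiv j p) = pderiv j (pderiv i p) := by
  have h : ⁅pderiv (R := ℝ) i, pderiv (R := ℝ) j⁆ = 0 := by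
    refine MvPolynomial.derivation_ext fun k => ?_
    simp [Derivation.commutator_apply, pderiv_X, Pi.single_apply, apply_ite]
  have := DFunLike.congr_fun h p
  rwa [Derivation.commutator_apply, Derivation.zero_apply, sub_eq_zero] at this

lemma isHomogeneous_polyLaplacian {p : MvPolynomial (Fin ζ) ℝ} {n : ℕ} (hp : p.IsHomogeneous n) :
    (polyLaplacian ζ p).IsHomogeneous (n - 2) := by
  rw [polyLaplacian_apply]
  refine IsHomogeneous.sum _ _ _ fun j _ => ?_
  have := hp.pderiv (i := j) |>.pderiv (i := j)
  rwa [Nat.sub_sub] at this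

lemma polyLaplacian_pderiv (j : Fin ζ) (p : MvPolynomial (Fin ζ) ℝ) :
    polyLaplacian ζ (pderiv j p) = pderiv j (polyLaplacian ζ p) := by
  simp only [polyLaplacian_apply, map_sum]
  refine Finset.sum_congr rfl fun i _ => ?_
  rw [pderiv_pderiv_comm i j p, pderiv_pderiv_comm i j]

lemma pderiv_eq_zero_of_isHomogeneous_zero {p : MvPolynomial (Fin ζ) ℝ} (hp : p.IsHomogeneous 0)
    (j : Fin ζ) : pderiv j p = 0 := by
  rw [← totalDegree_zero_iff_isHomogeneous, totalDegree_eq_zero_iff_eq_C] at hp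
  rw [hp, pderiv_C]

/-- Euler's identity turns `n h` into `∑ X_j ∂_j h`; integrating by parts then trades each `X_j` for
a derivative of `q ∂_j h`. -/
lemma natCast_mul_gaussInt_mul {h : MvPolynomial (Fin ζ) ℝ} {n : ℕ} (hh : h.IsHomogeneous n)
    (q : MvPolynomial (Fin ζ) ℝ) :
    n * gaussInt (q * h) = gaussInt (q * polyLaplacian ζ h) +
      ∑ j, gaussInt (pderiv j q * pderiv j h) := by
  have h1 : (n : ℝ) * gaussInt (q * h) = ∑ j, gaussInt (X j * (q * pderiv j h)) := by
    rw [← map_sum, ← smul_eq_mul, ← map_smul]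
    congr 1
    rw [← mul_smul_comm, Nat.cast_smul_eq_nsmul, ← hh.sum_X_mul_pderiv, Finset.mul_sum]
    exact Finset.sum_congr rfl fun j _ => by ring
  rw [h1, polyLaplacian_apply, Finset.mul_sum, map_sum, ← Finset.sum_add_distrib]
  refine Finset.sum_congr rfl fun j _ => ?_
  rw [← gaussInt_pderiv, ← map_add]
  congr 1
  rw [Derivation.leibniz, smul_eq_mul, smul_eq_mul]
  ring

lemma toSphere_real_univ_pos (hζ : 0 < ζ) :
    0 < (volume : Measure (EuclideanSpace ℝ (Fin ζ))).toSphere.real univ := by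
  have : Nonempty (Fin ζ) := ⟨⟨0, hζ⟩⟩
  exact ENNReal.toReal_pos (Measure.measure_univ_ne_zero.2 (Measure.toSphere_ne_zero _))
    (measure_ne_top _ _)

lemma sphInt_eq_zero_iff {p : MvPolynomial (Fin ζ) ℝ} {n : ℕ} (hp : p.IsHomogeneous n)
    (hζ : 0 < ζ) : sphInt ζ p = 0 ↔ gaussInt p = 0 := by
  rw [gaussInt_eq_sphInt hp hζ]
  rw [mul_eq_zero_iff_left
    (mul_pos (toSphere_real_univ_pos hζ) (radialMoment_pos hζ n)).ne']

/-- Green's identity for homogeneous polynomials on the unit sphere. -/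
lemma sphInt_polyLaplacian {p : MvPolynomial (Fin ζ) ℝ} {n : ℕ} (hp : p.IsHomogeneous n)
    (hζ : 0 < ζ) : n * (n + ζ - 2) * sphInt ζ p = sphInt ζ (polyLaplacian ζ p) := by
  have h := natCast_mul_gaussInt_mul hp 1
  simp only [one_mul, pderiv_one, zero_mul, map_zero, Finset.sum_const_zero, add_zero] at h
  -- In degrees `0` and `1` the Laplacian vanishes and `n - 2` truncates. The left factor need not
  -- vanish in degree `1`, so there the integral itself has to be shown zero.
  rcases n with _ | _ | n
  · have : polyLaplacian ζ p = 0 := by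
      rw [polyLaplacian_apply]
      exact Finset.sum_eq_zero fun j _ => by simp [pderiv_eq_zero_of_isHomogeneous_zero hp j]
    simp [this]
  · have h0 : polyLaplacian ζ p = 0 := by
      rw [polyLaplacian_apply]
      exact Finset.sum_eq_zero fun j _ => pderiv_eq_zero_of_isHomogeneous_zero hp.pderiv j
    rw [h0, map_zero] at h
    have : gaussInt p = 0 := by simpa using h
    rw [(sphInt_eq_zero_iff hp hζ).2 this, h0]; simp
  · have hσ := toSphere_real_univ_pos hζ
    have hM := radialMoment_pos hζ n
    rw [gaussInt_eq_sphInt hp hζ, gaussInt_eq_sphInt (isHomogeneous_polyLaplacian hp) hζ,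
      show n + 1 + 1 - 2 = n by omega, show n + 1 + 1 = n + 2 by ring,
      radialMoment_add_two hζ] at h
    refine mul_left_cancel₀ (mul_pos hσ hM).ne' ?_
    rw [← h]; push_cast; ring

/-- A harmonic homogeneous polynomial is orthogonal to the homogeneous polynomials of
smaller degree. -/
lemma gaussInt_mul_eq_zero {m n : ℕ} (hmn : m < n) {q h : MvPolynomial (Fin ζ) ℝ}
    (hq : q.IsHomogeneous m) (hh : h.IsHomogeneous n) (hΔ : polyLaplacian ζ h = 0) :
    gaussInt (q * h) = 0 := by
  -- With `h` harmonic only `∑ ∂_j q ∂_j h` survives: both degrees drop by one and `∂_j h` stays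
  -- harmonic, until `q` is constant.
  induction m generalizing n q h with
  | zero =>
    have := natCast_mul_gaussInt_mul hh q
    simp only [hΔ, mul_zero, map_zero, zero_add, pderiv_eq_zero_of_isHomogeneous_zero hq,
      zero_mul, Finset.sum_const_zero] at this
    exact (mul_eq_zero.1 this).resolve_left (by exact_mod_cast hmn.ne')
  | succ m ih =>
    have := natCast_mul_gaussInt_mul hh q
    rw [hΔ, mul_zero, map_zero, zero_add, Finset.sum_eq_zero fun j _ => ?_] at this
    · exact (mul_eq_zero.1 this).resolve_left (by exact_mod_cast (by omega : n ≠ 0))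
    · refine ih (by omega) hq.pderiv (hh.pderiv (i := j)) ?_
      rw [polyLaplacian_pderiv, hΔ, map_zero]

/-! ### Powers of linear forms -/

/-- The linear form `z ↦ ⟨v, z⟩`. -/
def linForm (v : Fin ζ → ℝ) : MvPolynomial (Fin ζ) ℝ := ∑ j, C (v j) * X j

/-- The directional derivative along `v`. -/
def dirDeriv (v : Fin ζ → ℝ) (p : MvPolynomial (Fin ζ) ℝ) : MvPolynomial (Fin ζ) ℝ :=
  ∑ j, C (v j) * pderiv j p

lemma isHomogeneous_linForm (v : Fin ζ → ℝ) : (linForm v).IsHomogeneous 1 :=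
  IsHomogeneous.sum _ _ _ fun j _ => by simpa using (isHomogeneous_C _ (v j)).mul (isHomogeneous_X ℝ j)

lemma pderiv_linForm (v : Fin ζ → ℝ) (j : Fin ζ) : pderiv j (linForm v) = C (v j) := by
  simp only [linForm, map_sum, Derivation.leibniz, pderiv_C, pderiv_X, smul_eq_mul, mul_zero,
    add_zero]
  rw [Finset.sum_eq_single j] <;> simp +contextual

lemma isHomogeneous_dirDeriv {p : MvPolynomial (Fin ζ) ℝ} {n : ℕ} (hp : p.IsHomogeneous n)
    (v : Fin ζ → ℝ) : (dirDeriv v p).IsHomogeneous (n - 1) :=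
  IsHomogeneous.sum _ _ _ fun j _ => by simpa using (isHomogeneous_C _ (v j)).mul hp.pderiv

lemma polyLaplacian_dirDeriv {p : MvPolynomial (Fin ζ) ℝ} (hp : polyLaplacian ζ p = 0)
    (v : Fin ζ → ℝ) : polyLaplacian ζ (dirDeriv v p) = 0 := by
  rw [dirDeriv, map_sum]
  refine Finset.sum_eq_zero fun j _ => ?_
  rw [← smul_eq_C_mul, map_smul, polyLaplacian_pderiv, hp, map_zero, smul_zero]

lemma eval_dirDeriv_self {p : MvPolynomial (Fin ζ) ℝ} {n : ℕ} (hp : p.IsHomogeneous n)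
    (v : Fin ζ → ℝ) : eval v (dirDeriv v p) = n * eval v p := by
  have h := congrArg (eval v) hp.sum_X_mul_pderiv
  simpa [dirDeriv] using h

/-- Leibniz rule: the linear form has constant gradient `v` of norm one, and the term with the
Laplacian of `q` drops out. -/
lemma polyLaplacian_linForm_pow_mul {v : Fin ζ → ℝ} (hv : ∑ j, v j ^ 2 = 1) (m : ℕ)
    {q : MvPolynomial (Fin ζ) ℝ} (hq : polyLaplacian ζ q = 0) :
    polyLaplacian ζ (linForm v ^ m * q) =
      ((m * (m - 1 : ℕ) : ℕ) : ℝ) • (linForm v ^ (m - 2) * q) +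
        (2 * m : ℝ) • (linForm v ^ (m - 1) * dirDeriv v q) := by
  have hterm : ∀ j, pderiv j (pderiv j (linForm v ^ m * q)) =
      C (v j ^ 2) * (((m * (m - 1 : ℕ) : ℕ) : ℝ) • (linForm v ^ (m - 2) * q)) +
        (2 * m : ℝ) • (linForm v ^ (m - 1) * (C (v j) * pderiv j q)) +
        linForm v ^ m * pderiv j (pderiv j q) := by
    intro j
    simp only [Derivation.leibniz, Derivation.leibniz_pow, smul_eq_mul, map_add, pderiv_linForm,
      smul_eq_C_mul, nsmul_eq_mul, map_mul, map_pow, map_natCast, map_ofNat, pderiv_C, mul_zero,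
      Derivation.map_natCast, Nat.sub_sub, Nat.cast_mul]
    ring
  rw [polyLaplacian_apply, Finset.sum_congr rfl fun j _ => hterm j, Finset.sum_add_distrib,
    Finset.sum_add_distrib, ← Finset.sum_mul, ← Finset.smul_sum, ← Finset.mul_sum,
    ← Finset.mul_sum, ← map_sum, hv, ← polyLaplacian_apply, hq, dirDeriv, map_one, one_mul,
    mul_zero, add_zero]

/-- Green's identity as a recursion in `(m, k)`: apart from terms with zero coefficient, the right
side lives at `(m - 2, k)` and `(m - 1, k - 1)`. -/
lemma sphInt_linForm_pow_mul {v : Fin ζ → ℝ} (hv : ∑ j, v j ^ 2 = 1) (hζ : 0 < ζ) (m k : ℕ)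
    {q : MvPolynomial (Fin ζ) ℝ} (hq : q.IsHomogeneous k) (hΔ : polyLaplacian ζ q = 0) :
    (m + k : ℝ) * (m + k + ζ - 2) * sphInt ζ (linForm v ^ m * q) =
      (m * (m - 1 : ℕ) : ℕ) * sphInt ζ (linForm v ^ (m - 2) * q) +
        2 * m * sphInt ζ (linForm v ^ (m - 1) * dirDeriv v q) := by
  have hh : (linForm v ^ m * q).IsHomogeneous (m + k) := by
    simpa using ((isHomogeneous_linForm v).pow m).mul hq
  have h := sphInt_polyLaplacian hh hζ
  rw [polyLaplacian_linForm_pow_mul hv m hΔ, map_add, map_smul, map_smul] at h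
  simpa using h

lemma dirDeriv_eq_zero {q : MvPolynomial (Fin ζ) ℝ} (hq : q.IsHomogeneous 0) (v : Fin ζ → ℝ) :
    dirDeriv v q = 0 :=
  Finset.sum_eq_zero fun j _ => by rw [pderiv_eq_zero_of_isHomogeneous_zero hq, mul_zero]

/-- The condition means `m < k` or wrong parity; it is inherited along the recursion and excludes `m
= k = 0`, the one case in which the left coefficient could vanish. -/
lemma sphInt_linForm_pow_mul_eq_zero {v : Fin ζ → ℝ} (hv : ∑ j, v j ^ 2 = 1) (hζ : 2 ≤ ζ)
    {m k : ℕ} (hmk : ∀ j, m ≠ k + 2 * j)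
    {q : MvPolynomial (Fin ζ) ℝ} (hq : q.IsHomogeneous k) (hΔ : polyLaplacian ζ q = 0) :
    sphInt ζ (linForm v ^ m * q) = 0 := by
  induction hN : m + k using Nat.strong_induction_on generalizing m k q with
  | _ N ih =>
  subst hN
  have h := sphInt_linForm_pow_mul hv (by omega) m k hq hΔ
  have h1 : ((m * (m - 1 : ℕ) : ℕ) : ℝ) * sphInt ζ (linForm v ^ (m - 2) * q) = 0 := by
    rcases m with _ | _ | m
    · simp
    · simp
    · rw [show m + 1 + 1 - 2 = m from rfl, @ih (m + k) (by omega) m k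
        (fun j hj => hmk (j + 1) (by omega)) q hq hΔ rfl, mul_zero]
  have h2 : (2 * m : ℝ) * sphInt ζ (linForm v ^ (m - 1) * dirDeriv v q) = 0 := by
    rcases k with _ | k
    · simp [dirDeriv_eq_zero hq]
    rcases m with _ | m
    · simp
    · rw [show m + 1 - 1 = m from rfl, @ih (m + k) (by omega) m k
        (fun j hj => hmk j (by omega)) _ (isHomogeneous_dirDeriv hq v) (polyLaplacian_dirDeriv hΔ v)
        rfl, mul_zero]
  rw [h1, h2, add_zero] at h
  have hpos : 0 < m + k := by
    by_contra hcon
    exact hmk 0 (by omega)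
  have e1 : (0 : ℝ) < m + k := by exact_mod_cast hpos
  have e2 : (2 : ℝ) ≤ ζ := by exact_mod_cast hζ
  exact (mul_eq_zero.1 h).resolve_left (mul_pos e1 (by linarith)).ne'

/-- With `powCoeff_succ_left`, this evaluates the two terms of the recursion
`sphInt_linForm_pow_mul` on the closed form. -/
lemma powCoeff_succ_right (hζ : 0 < ζ) (k j : ℕ) :
    (k + 2 * j + 2) * (k + 2 * j + 1) * powCoeff ζ k j =
      4 * (j + 1) * (k + j + ζ / 2) * powCoeff ζ k (j + 1) := by
  have hp : (0 : ℝ) < k + j + ζ / 2 := by positivity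
  have hG := (Gamma_pos_of_pos hp).ne'
  unfold powCoeff
  rw [show (k : ℝ) + (j + 1 : ℕ) + ζ / 2 = k + j + ζ / 2 + 1 by push_cast; ring,
    Gamma_add_one hp.ne', show k + 2 * (j + 1) = k + 2 * j + 1 + 1 by ring, Nat.factorial_succ,
    Nat.factorial_succ, Nat.factorial_succ, pow_succ, pow_succ]
  have := hp.ne'
  push_cast
  field_simp
  ring

lemma powCoeff_succ_left (hζ : 0 < ζ) (k j : ℕ) :
    (k + 2 * j + 1) * powCoeff ζ k j = 2 * (k + j + ζ / 2) * powCoeff ζ (k + 1) j := by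
  have hp : (0 : ℝ) < k + j + ζ / 2 := by positivity
  have hG := (Gamma_pos_of_pos hp).ne'
  unfold powCoeff
  rw [show ((k + 1 : ℕ) : ℝ) + j + ζ / 2 = k + j + ζ / 2 + 1 by push_cast; ring,
    Gamma_add_one hp.ne', show k + 1 + 2 * j = k + 2 * j + 1 by ring, Nat.factorial_succ, pow_succ]
  have := hp.ne'
  push_cast
  field_simp

/-- Induction on `k + j`, since the recursion leads to `(k, j - 1)` and `(k - 1, j)`. Euler's
identity gives back `q` from its derivative along `v` at `v`, and the two contributions,
proportional to `j` and `k`, add up to the left coefficient. -/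
lemma sphInt_linForm_pow_mul_eq {v : Fin ζ → ℝ} (hv : ∑ j, v j ^ 2 = 1) (hζ : 2 ≤ ζ)
    (k j : ℕ) {q : MvPolynomial (Fin ζ) ℝ} (hq : q.IsHomogeneous k)
    (hΔ : polyLaplacian ζ q = 0) :
    sphInt ζ (linForm v ^ (k + 2 * j) * q) = powCoeff ζ k j * eval v q := by
  have hζ0 : 0 < ζ := by omega
  have e2 : (2 : ℝ) ≤ ζ := by exact_mod_cast hζ
  induction hN : k + j using Nat.strong_induction_on generalizing k j q with
  | _ N ih =>
  subst hN
  rcases Nat.eq_zero_or_pos (k + j) with h0 | hpos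
  · obtain ⟨rfl, rfl⟩ : k = 0 ∧ j = 0 := by omega
    rw [← totalDegree_zero_iff_isHomogeneous, totalDegree_eq_zero_iff_eq_C] at hq
    have := isProbabilityMeasure_unifSph hζ0
    have hG : Gamma ((ζ : ℝ) / 2) ≠ 0 := (Gamma_pos_of_pos (by positivity)).ne'
    rw [hq]
    simp [sphInt, restrictSph_apply, powCoeff, hG]
  have h := sphInt_linForm_pow_mul hv hζ0 (k + 2 * j) k hq hΔ
  have h1 : ((((k + 2 * j) * (k + 2 * j - 1 : ℕ) : ℕ) : ℝ)) *
      sphInt ζ (linForm v ^ (k + 2 * j - 2) * q) =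
      4 * j * (k + j - 1 + ζ / 2) * powCoeff ζ k j * eval v q := by
    -- For `j = 0` the power `k - 2` is below the frequency, so the integral vanishes.
    rcases j with _ | j
    · rcases k with _ | _ | k
      · simp
      · simp
      · rw [sphInt_linForm_pow_mul_eq_zero hv hζ (fun i => by omega) hq hΔ]; simp
    · rw [show k + 2 * (j + 1) - 2 = k + 2 * j by omega,
        show k + 2 * (j + 1) - 1 = k + 2 * j + 1 by omega, ih (k + j) (by omega) k j hq hΔ rfl]
      have := powCoeff_succ_right hζ0 k j
      push_cast
      linear_combination eval v q * this
  have h2 : (2 * (k + 2 * j : ℕ) : ℝ) * sphInt ζ (linForm v ^ (k + 2 * j - 1) * dirDeriv v q) =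
      4 * k * (k + j - 1 + ζ / 2) * powCoeff ζ k j * eval v q := by
    rcases k with _ | k
    · simp [dirDeriv_eq_zero hq]
    · rw [show k + 1 + 2 * j - 1 = k + 2 * j by omega, ih (k + j) (by omega) k j
        (isHomogeneous_dirDeriv hq v) (polyLaplacian_dirDeriv hΔ v) rfl, eval_dirDeriv_self hq]
      have := powCoeff_succ_left hζ0 k j
      push_cast
      linear_combination 2 * (k + 1) * eval v q * this
  rw [h1, h2] at h
  have e1 : (0 : ℝ) < k + j := by exact_mod_cast hpos
  have e3 : (1 : ℝ) ≤ k + j := by exact_mod_cast hpos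
  refine mul_left_cancel₀ (mul_pos e1 (show (0 : ℝ) < 4 * (k + j - 1 + ζ / 2) by linarith)).ne' ?_
  push_cast at h
  linear_combination h

end Multisphere

end

noncomputable section

namespace Multisphere

open Filter Topology Real Set MvPolynomial

/-! ### Decomposition into spherical harmonics -/

variable {ζ : ℕ}

/-- The polynomial `|z|²`. -/
def sqNorm (ζ : ℕ) : MvPolynomial (Fin ζ) ℝ := ∑ j, X j ^ 2

lemma isHomogeneous_sqNorm : (sqNorm ζ).IsHomogeneous 2 :=
  IsHomogeneous.sum _ _ _ fun j _ => isHomogeneous_X_pow j 2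

lemma sum_sq_eq_one (x : Sph ζ) : ∑ j, (x : EuclideanSpace ℝ (Fin ζ)).ofLp j ^ 2 = 1 := by
  have h : ‖(x : EuclideanSpace ℝ (Fin ζ))‖ ^ 2 = 1 := by
    rw [norm_eq_of_mem_sphere x, one_pow]
  rw [EuclideanSpace.norm_sq_eq] at h
  simpa using h

lemma restrictSph_sqNorm : restrictSph ζ (sqNorm ζ) = 1 := by
  ext x
  rw [restrictSph_apply]
  simpa [sqNorm] using sum_sq_eq_one x

lemma eq_zero_of_gaussInt_mul_self {q : MvPolynomial (Fin ζ) ℝ} (h : gaussInt (q * q) = 0) :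
    q = 0 := by
  rw [gaussInt_apply, integral_eq_zero_iff_of_nonneg _ (integrable_eval_mul_exp _)] at h
  · have h' := (Continuous.ae_eq_iff_eq volume ((continuous_eval_ofLp (q * q)).mul (by fun_prop))
      continuous_const).1 h
    refine MvPolynomial.funext fun v => ?_
    have := congrFun h' (WithLp.toLp 2 v)
    have h2 : eval v q * eval v q * exp (-‖WithLp.toLp 2 v‖ ^ 2 / 2) = 0 := by
      rw [← map_mul]; exact this
    rw [map_zero]
    exact mul_self_eq_zero.1 ((mul_eq_zero.1 h2).resolve_right (exp_pos _).ne')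
  · intro z
    simp only [map_mul, Pi.zero_apply]
    exact mul_nonneg (mul_self_nonneg _) (exp_pos _).le

/-- A harmonic `|z|² q` is orthogonal to `q`, which has smaller degree; on the sphere `|z|² = 1`, so
`q²` integrates to zero. -/
lemma eq_zero_of_polyLaplacian_sqNorm_mul {q : MvPolynomial (Fin ζ) ℝ} {m : ℕ}
    (hq : q.IsHomogeneous m) (hζ : 0 < ζ) (h : polyLaplacian ζ (sqNorm ζ * q) = 0) : q = 0 := by
  have hh : (sqNorm ζ * q).IsHomogeneous (2 + m) := isHomogeneous_sqNorm.mul hq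
  have h1 := (sphInt_eq_zero_iff (hq.mul hh) hζ).2 (gaussInt_mul_eq_zero (by omega) hq hh h)
  have h2 : sphInt ζ (q * q) = 0 := by
    rw [← h1]
    simp [sphInt, restrictSph_sqNorm]
  exact eq_zero_of_gaussInt_mul_self ((sphInt_eq_zero_iff (hq.mul hq) hζ).1 h2)

instance finiteDimensional_homogeneousSubmodule (n : ℕ) :
    FiniteDimensional ℝ (homogeneousSubmodule (Fin ζ) ℝ n) :=
  Submodule.finiteDimensional_of_le (S₂ := restrictTotalDegree (Fin ζ) ℝ n) fun _ hp =>
    (mem_restrictTotalDegree _ _ _).2 (IsHomogeneous.totalDegree_le hp)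

instance finiteDimensional_sphHarm (k : ℕ) : FiniteDimensional ℝ (sphHarm ζ k) := by
  have : FiniteDimensional ℝ
      (homogeneousSubmodule (Fin ζ) ℝ k ⊓ LinearMap.ker (polyLaplacian ζ) : Submodule ℝ _) :=
    Submodule.finiteDimensional_of_le inf_le_left
  unfold sphHarm
  infer_instance

lemma restrictSph_mem_sphHarm {p : MvPolynomial (Fin ζ) ℝ} {n : ℕ} (hp : p.IsHomogeneous n)
    (hΔ : polyLaplacian ζ p = 0) : restrictSph ζ p ∈ sphHarm ζ n :=
  ⟨p, ⟨hp, hΔ⟩, rfl⟩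

/-- Every polynomial differs from a harmonic one by a multiple of `|z|²`. -/
lemma exists_polyLaplacian_sqNorm_mul_eq (hζ : 0 < ζ) {p : MvPolynomial (Fin ζ) ℝ} {m : ℕ}
    (hp : p.IsHomogeneous m) :
    ∃ q : MvPolynomial (Fin ζ) ℝ, q.IsHomogeneous m ∧ polyLaplacian ζ (sqNorm ζ * q) = p := by
  let V := homogeneousSubmodule (Fin ζ) ℝ m
  have hmap : ∀ q ∈ V, (polyLaplacian ζ ∘ₗ LinearMap.mulLeft ℝ (sqNorm ζ)) q ∈ V := fun q hq => by
    have := isHomogeneous_polyLaplacian ((isHomogeneous_sqNorm (ζ := ζ)).mul hq)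
    rwa [Nat.add_sub_cancel_left] at this
  -- An injective endomorphism of the finite-dimensional space of forms of degree `m` is surjective.
  have hinj : Function.Injective
      ((polyLaplacian ζ ∘ₗ LinearMap.mulLeft ℝ (sqNorm ζ)).restrict hmap) := by
    rw [← LinearMap.ker_eq_bot, LinearMap.ker_eq_bot']
    intro q hq
    have := congrArg Subtype.val hq
    exact Subtype.ext (eq_zero_of_polyLaplacian_sqNorm_mul q.2 hζ this)
  obtain ⟨q, hq⟩ := LinearMap.surjective_of_injective hinj ⟨p, hp⟩
  exact ⟨q.1, q.2, congrArg Subtype.val hq⟩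

/-- Subtract `|z|² q` with the same Laplacian as `p`: the difference is harmonic, and `|z|² q`
restricts to `q`, of degree `n - 2`. -/
lemma restrictSph_mem_iSup_of_isHomogeneous (hζ : 0 < ζ) {p : MvPolynomial (Fin ζ) ℝ} {n : ℕ}
    (hp : p.IsHomogeneous n) : restrictSph ζ p ∈ ⨆ k, sphHarm ζ k := by
  induction n using Nat.strong_induction_on generalizing p with
  | _ n ih =>
  by_cases hn : n < 2
  · refine Submodule.mem_iSup_of_mem n (restrictSph_mem_sphHarm hp ?_)
    rw [polyLaplacian_apply]
    refine Finset.sum_eq_zero fun j _ => pderiv_eq_zero_of_isHomogeneous_zero ?_ j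
    have := hp.pderiv (i := j)
    rwa [show n - 1 = 0 by omega] at this
  · obtain ⟨q, hq, hqp⟩ := exists_polyLaplacian_sqNorm_mul_eq hζ (isHomogeneous_polyLaplacian hp)
    have hsq : (sqNorm ζ * q).IsHomogeneous n := by
      have := isHomogeneous_sqNorm.mul hq
      rwa [show 2 + (n - 2) = n by omega] at this
    have hsplit : restrictSph ζ p = restrictSph ζ (p - sqNorm ζ * q) + restrictSph ζ q := by
      simp [restrictSph_sqNorm]
    rw [hsplit]
    refine add_mem (Submodule.mem_iSup_of_mem n (restrictSph_mem_sphHarm (hp.sub hsq) ?_))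
      (ih (n - 2) (by omega) hq)
    rw [map_sub, hqp, sub_self]

/-- Polynomials restricted to the sphere are sums of spherical harmonics. -/
theorem restrictSph_mem_iSup (hζ : 0 < ζ) (p : MvPolynomial (Fin ζ) ℝ) :
    restrictSph ζ p ∈ ⨆ k, sphHarm ζ k := by
  rw [← sum_homogeneousComponent p, map_sum]
  exact sum_mem fun i _ =>
    restrictSph_mem_iSup_of_isHomogeneous hζ (homogeneousComponent_isHomogeneous i p)

lemma integral_mul_eq_zero_of_ne (hζ : 0 < ζ) {k l : ℕ} (hkl : k ≠ l) {f g : C(Sph ζ, ℝ)}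
    (hf : f ∈ sphHarm ζ k) (hg : g ∈ sphHarm ζ l) : ∫ x, f x * g x ∂(unifSph ζ) = 0 := by
  wlog hlt : k < l generalizing k l f g
  · simp only [mul_comm (f _)]
    exact this hkl.symm hg hf (by omega)
  obtain ⟨p, ⟨hp, -⟩, rfl⟩ := hf
  obtain ⟨q, ⟨hq, hq'⟩, rfl⟩ := hg
  have h := (sphInt_eq_zero_iff (hp.mul hq) hζ).2 (gaussInt_mul_eq_zero hlt hp hq hq')
  rw [← h]
  simp [sphInt]

/-- Orthonormality gives independence, and the number of functions is the dimension. -/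
lemma span_range_eq_sphHarm {Y : (k : ℕ) → Fin (numHarm ζ k) → C(Sph ζ, ℝ)}
    (hY : IsHarmonicSystem ζ Y) (k : ℕ) : Submodule.span ℝ (range (Y k)) = sphHarm ζ k := by
  have hli : LinearIndependent ℝ (Y k) := by
    rw [Fintype.linearIndependent_iff]
    intro a ha i
    have hInt : ∀ f : C(Sph ζ, ℝ), Integrable f (unifSph ζ) := fun f =>
      f.continuous.integrable_of_hasCompactSupport (HasCompactSupport.of_compactSpace _)
    have h0 : ∫ x, (∑ j, a j • Y k j) x * Y k i x ∂(unifSph ζ) = 0 := by simp [ha]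
    have h1 : ∫ x, (∑ j, a j • Y k j) x * Y k i x ∂(unifSph ζ) = a i := by
      simp only [ContinuousMap.coe_sum, Finset.sum_apply, ContinuousMap.smul_apply, smul_eq_mul,
        Finset.sum_mul, mul_assoc]
      have hInt' : ∀ j ∈ Finset.univ,
          Integrable (fun x => a j * (Y k j x * Y k i x)) (unifSph ζ) :=
        fun j _ => (hInt (Y k j * Y k i)).const_mul (a j)
      rw [integral_finsetSum _ hInt']
      simp [integral_const_mul, hY.2]
    rw [← h1, h0]
  refine Submodule.eq_of_le_of_finrank_eq (Submodule.span_le.2 ?_) ?_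
  · rintro _ ⟨j, rfl⟩
    exact hY.1 k j
  · rw [finrank_span_eq_card hli, Fintype.card_fin, numHarm]

/-! ### Products over the pixels -/

variable {d : ℕ}

lemma integral_prod_unif (f : Fin d → Sph ζ → ℝ) :
    ∫ x, ∏ i, f i (x i) ∂(unif ζ d) = ∏ i, ∫ x, f i x ∂(unifSph ζ) :=
  integral_fintype_prod_eq_prod f

lemma shProduct_orthonormal (hζ : 0 < ζ) {Y : (k : ℕ) → Fin (numHarm ζ k) → C(Sph ζ, ℝ)}
    (hY : IsHarmonicSystem ζ Y) :
    Orthonormal ℝ (fun p => ContinuousMap.toLp (E := ℝ) 2 (unif ζ d) ℝ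
        (shProduct (d := d) Y p)) := by
  rw [orthonormal_iff_ite]
  rintro ⟨k, j⟩ ⟨k', j'⟩
  rw [ContinuousMap.inner_toLp]
  have h : ∀ x : MS ζ d, shProduct Y ⟨k', j'⟩ x * (starRingEnd ℝ) (shProduct Y ⟨k, j⟩ x) =
      ∏ i, Y (k i) (j i) (x i) * Y (k' i) (j' i) (x i) := fun x => by
    simp [shProduct, prodFun, Finset.prod_mul_distrib, mul_comm]
  simp only [h]
  rw [integral_prod_unif (fun i x => Y (k i) (j i) x * Y (k' i) (j' i) x)]
  split_ifs with heq
  · cases heq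
    exact Finset.prod_eq_one fun i _ => by simp [hY.2]
  · by_cases hk : k = k'
    · subst hk
      obtain ⟨i, hi⟩ : ∃ i, j i ≠ j' i := by
        by_contra! hcon
        exact heq (by rw [funext hcon])
      exact Finset.prod_eq_zero (Finset.mem_univ i) (by simp [hY.2, hi])
    · obtain ⟨i, hi⟩ := Function.ne_iff.1 hk
      exact Finset.prod_eq_zero (Finset.mem_univ i)
        (integral_mul_eq_zero_of_ne hζ hi (hY.1 _ _) (hY.1 _ _))

lemma prodFun_mul (f g : Fin d → C(Sph ζ, ℝ)) :
    prodFun f * prodFun g = prodFun (fun i => f i * g i) := by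
  ext x; simp [prodFun, Finset.prod_mul_distrib]

lemma prodFun_update_apply (f : Fin d → C(Sph ζ, ℝ)) (i : Fin d) (g : C(Sph ζ, ℝ)) (x : MS ζ d) :
    prodFun (Function.update f i g) x = g (x i) * ∏ l ∈ Finset.univ.erase i, f l (x l) := by
  simp only [prodFun, ContinuousMap.coe_mk]
  rw [← Finset.mul_prod_erase _ _ (Finset.mem_univ i), Function.update_self]
  congr 1
  exact Finset.prod_congr rfl fun l hl => by rw [Function.update_of_ne (Finset.ne_of_mem_erase hl)]

/-- If the factors lie in the span of a set, the product function lies in the span of the product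
functions of that set. -/
lemma prodFun_mem_span {s : Set C(Sph ζ, ℝ)} {f : Fin d → C(Sph ζ, ℝ)}
    (hf : ∀ i, f i ∈ Submodule.span ℝ s) :
    prodFun f ∈ Submodule.span ℝ (prodFun '' {g : Fin d → C(Sph ζ, ℝ) | ∀ i, g i ∈ s}) := by
  -- Outside `t` the factors already lie in `s`; multilinearity enlarges `t` one coordinate at a
  -- time.
  suffices H : ∀ (t : Finset (Fin d)) (f : Fin d → C(Sph ζ, ℝ)),
      (∀ i, f i ∈ Submodule.span ℝ s) → (∀ i ∉ t, f i ∈ s) →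
      prodFun f ∈ Submodule.span ℝ (prodFun '' {g : Fin d → C(Sph ζ, ℝ) | ∀ i, g i ∈ s}) from
    H Finset.univ f hf fun i hi => absurd (Finset.mem_univ i) hi
  clear hf f
  intro t
  induction t using Finset.induction_on with
  | empty => exact fun f _ hf => Submodule.subset_span ⟨f, fun i => hf i (Finset.notMem_empty i), rfl⟩
  | insert i t _ ih =>
    intro f hf hft
    have key : ∀ g ∈ Submodule.span ℝ s, prodFun (Function.update f i g) ∈
        Submodule.span ℝ (prodFun '' {g : Fin d → C(Sph ζ, ℝ) | ∀ i, g i ∈ s}) := by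
      intro g hg
      induction hg using Submodule.span_induction with
      | mem g hg =>
        refine ih _ (fun l => ?_) fun l hl => ?_
        · by_cases hli : l = i
          · subst hli; rw [Function.update_self]; exact Submodule.subset_span hg
          · rw [Function.update_of_ne hli]; exact hf l
        · by_cases hli : l = i
          · subst hli; rwa [Function.update_self]
          · rw [Function.update_of_ne hli]; exact hft l (by simp [hli, hl])
      | zero =>
        have : prodFun (Function.update f i 0) = 0 := by ext x; simp [prodFun_update_apply]
        rw [this]; exact zero_mem _
      | add g g' _ _ h h' =>
        have : prodFun (Function.update f i (g + g')) =
            prodFun (Function.update f i g) + prodFun (Function.update f i g') := by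
          ext x; simp [prodFun_update_apply, add_mul]
        rw [this]; exact add_mem h h'
      | smul a g _ h =>
        have : prodFun (Function.update f i (a • g)) = a • prodFun (Function.update f i g) := by
          ext x; simp [prodFun_update_apply, mul_assoc]
        rw [this]; exact Submodule.smul_mem _ a h
    simpa using key (f i) (hf i)

/-- Stone–Weierstrass: products of polynomial functions are closed under multiplication, so the
algebra they generate is their linear span, and coordinates separate points. Decomposing each factor
into harmonics puts this algebra inside the span of the SH-products. -/
lemma span_shProduct_topologicalClosure (hζ : 0 < ζ)
    {Y : (k : ℕ) → Fin (numHarm ζ k) → C(Sph ζ, ℝ)} (hY : IsHarmonicSystem ζ Y) :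
    (Submodule.span ℝ (range (shProduct (d := d) Y))).topologicalClosure = ⊤ := by
  set s : Set C(Sph ζ, ℝ) := ⋃ k, range (Y k) with hs
  have hspan : ∀ p, restrictSph ζ p ∈ Submodule.span ℝ s := fun p => by
    rw [hs, Submodule.span_iUnion]
    simp only [span_range_eq_sphHarm hY]
    exact restrictSph_mem_iSup hζ p
  have hprod : ∀ f : Fin d → C(Sph ζ, ℝ), (∀ i, f i ∈ (restrictSph ζ).range) →
      prodFun f ∈ Submodule.span ℝ (range (shProduct (d := d) Y)) := by
    intro f hf
    refine Submodule.span_mono ?_ (prodFun_mem_span (s := s) (f := f) fun i => ?_)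
    · rintro _ ⟨g, hg, rfl⟩
      have : ∀ i, ∃ k j, Y k j = g i := fun i => by simpa [hs] using hg i
      choose k j hkj using this
      exact ⟨⟨k, j⟩, by simp [shProduct, hkj]⟩
    · obtain ⟨p, hp⟩ := hf i
      rw [← hp]; exact hspan p
  let gen : Set C(MS ζ d, ℝ) :=
    prodFun '' {f : Fin d → C(Sph ζ, ℝ) | ∀ i, f i ∈ (restrictSph ζ).range}
  let N : Submonoid C(MS ζ d, ℝ) :=
    { carrier := gen
      mul_mem' := by
        rintro _ _ ⟨f, hf, rfl⟩ ⟨g, hg, rfl⟩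
        exact ⟨_, fun i => mul_mem (hf i) (hg i), (prodFun_mul f g).symm⟩
      one_mem' := ⟨fun _ => 1, fun i => one_mem _, by ext x; simp [prodFun]⟩ }
  have hcl : (Submonoid.closure gen : Set C(MS ζ d, ℝ)) = gen := by
    have : Submonoid.closure (N : Set C(MS ζ d, ℝ)) = N := Submonoid.closure_eq N
    exact congrArg SetLike.coe this
  have hle : Subalgebra.toSubmodule (Algebra.adjoin ℝ gen) ≤
      Submodule.span ℝ (range (shProduct (d := d) Y)) := by
    rw [Algebra.adjoin_eq_span, hcl, Submodule.span_le]
    rintro _ ⟨f, hf, rfl⟩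
    exact hprod f hf
  have hsep : (Algebra.adjoin ℝ gen).SeparatesPoints := by
    intro x y hxy
    obtain ⟨i, hi⟩ := Function.ne_iff.1 hxy
    obtain ⟨j, hj⟩ : ∃ j, (x i : EuclideanSpace ℝ (Fin ζ)) j ≠ (y i : EuclideanSpace ℝ (Fin ζ)) j := by
      by_contra! hcon
      exact hi (Subtype.ext (PiLp.ext hcon))
    let f : Fin d → C(Sph ζ, ℝ) := Function.update (fun _ => 1) i (restrictSph ζ (X j))
    refine ⟨prodFun f, ⟨prodFun f, Algebra.subset_adjoin ⟨f, fun l => ?_, rfl⟩, rfl⟩, ?_⟩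
    · by_cases hl : l = i
      · subst hl; simp [f]
      · simp only [f, Function.update_of_ne hl]; exact one_mem _
    · simp only [f, prodFun_update_apply, restrictSph_apply, eval_X]
      simpa using hj
  have htop := ContinuousMap.subalgebra_topologicalClosure_eq_top_of_separatesPoints _ hsep
  rw [eq_top_iff]
  intro g _
  have hg : g ∈ closure ((Algebra.adjoin ℝ gen : Subalgebra ℝ C(MS ζ d, ℝ)) : Set C(MS ζ d, ℝ)) := by
    have : g ∈ (Algebra.adjoin ℝ gen).topologicalClosure := by rw [htop]; trivial
    exact this
  exact closure_mono hle hg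

/-- The SH-products span a dense subspace of `L²`. -/
lemma span_toLp_shProduct_topologicalClosure (hζ : 0 < ζ)
    {Y : (k : ℕ) → Fin (numHarm ζ k) → C(Sph ζ, ℝ)} (hY : IsHarmonicSystem ζ Y) :
    (Submodule.span ℝ (Set.range fun p => ContinuousMap.toLp (E := ℝ) 2 (unif ζ d) ℝ
        (shProduct (d := d) Y p))).topologicalClosure = ⊤ := by
  have := (ContinuousMap.toLp_denseRange ℝ (unif ζ d) ℝ
    (p := 2) (by norm_num)).topologicalClosure_map_submodule
    (span_shProduct_topologicalClosure (d := d) hζ hY)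
  rw [Submodule.map_span, ← range_comp] at this
  exact this

/-! ### The Funk–Hecke formula for power series kernels -/

lemma integral_inner_pow_mul (hζ : 2 ≤ ζ) {k : ℕ} {f : C(Sph ζ, ℝ)} (hf : f ∈ sphHarm ζ k)
    (x : Sph ζ) :
    (∀ j, ∫ z, inner ℝ (x : EuclideanSpace ℝ (Fin ζ)) (z : EuclideanSpace ℝ (Fin ζ)) ^ (k + 2 * j) *
        f z ∂(unifSph ζ) = powCoeff ζ k j * f x) ∧
    ∀ m, (∀ j, m ≠ k + 2 * j) →
      ∫ z, inner ℝ (x : EuclideanSpace ℝ (Fin ζ)) (z : EuclideanSpace ℝ (Fin ζ)) ^ m *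
        f z ∂(unifSph ζ) = 0 := by
  obtain ⟨q, ⟨hq, hΔ⟩, rfl⟩ := hf
  set v := (x : EuclideanSpace ℝ (Fin ζ)).ofLp
  have hv : ∑ j, v j ^ 2 = 1 := sum_sq_eq_one x
  have hInt : ∀ m, ∫ z, inner ℝ (x : EuclideanSpace ℝ (Fin ζ)) (z : EuclideanSpace ℝ (Fin ζ)) ^ m *
        (restrictSph ζ).toLinearMap q z ∂(unifSph ζ) = sphInt ζ (linForm v ^ m * q) := fun m => by
    change _ = ∫ z, restrictSph ζ (linForm v ^ m * q) z ∂(unifSph ζ)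
    congr 1; funext z
    rw [AlgHom.toLinearMap_apply, restrictSph_apply, restrictSph_apply, map_mul, map_pow]
    congr 2
    simp [linForm, PiLp.inner_apply, v, mul_comm]
  refine ⟨fun j => ?_, fun m hm => ?_⟩
  · rw [hInt, sphInt_linForm_pow_mul_eq hv hζ k j hq hΔ, AlgHom.toLinearMap_apply, restrictSph_apply]
  · rw [hInt, sphInt_linForm_pow_mul_eq_zero hv hζ hm hq hΔ]

/-- The eigenvalues of a dot product kernel given by a power series. -/
theorem integral_kernel_mul (hζ : 2 ≤ ζ) {ρ : ℕ → ℝ} (h0 : ∀ m, 0 ≤ ρ m) (hρ : Summable ρ)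
    {g : ℝ → ℝ} (hg : ∀ t ∈ Icc (-1 : ℝ) 1, HasSum (fun m => ρ m * t ^ m) (g t))
    {k : ℕ} {f : C(Sph ζ, ℝ)} (hf : f ∈ sphHarm ζ k) (x : Sph ζ) :
    ∫ z, g (inner ℝ (x : EuclideanSpace ℝ (Fin ζ)) (z : EuclideanSpace ℝ (Fin ζ))) * f z
      ∂(unifSph ζ) = eigenSum ζ ρ k * f x := by
  have hmem : ∀ z : Sph ζ,
      |inner ℝ (x : EuclideanSpace ℝ (Fin ζ)) (z : EuclideanSpace ℝ (Fin ζ))| ≤ 1 := fun z => by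
    have := abs_real_inner_le_norm (x : EuclideanSpace ℝ (Fin ζ)) (z : EuclideanSpace ℝ (Fin ζ))
    rwa [norm_eq_of_mem_sphere, norm_eq_of_mem_sphere, one_mul] at this
  set F : ℕ → Sph ζ → ℝ := fun m z => ρ m *
    (inner ℝ (x : EuclideanSpace ℝ (Fin ζ)) (z : EuclideanSpace ℝ (Fin ζ)) ^ m * f z) with hF
  have hsum : HasSum (fun m => ∫ z, F m z ∂(unifSph ζ)) (∫ z, g (inner ℝ
      (x : EuclideanSpace ℝ (Fin ζ)) (z : EuclideanSpace ℝ (Fin ζ))) * f z ∂(unifSph ζ)) := by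
    refine hasSum_integral_of_dominated_convergence (fun m _ => ρ m * ‖f‖) ?_ ?_ ?_ ?_ ?_
    · intro m
      refine Continuous.aestronglyMeasurable ?_
      fun_prop
    · refine fun m => ae_of_all _ fun z => ?_
      rw [hF, norm_mul, norm_mul, norm_pow, Real.norm_of_nonneg (h0 m), Real.norm_eq_abs]
      refine mul_le_mul_of_nonneg_left ?_ (h0 m)
      calc _ ≤ 1 * ‖f‖ := mul_le_mul (pow_le_one₀ (abs_nonneg _) (hmem z)) (f.norm_coe_le_norm z)
            (norm_nonneg _) zero_le_one
        _ = _ := one_mul _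
    · exact ae_of_all _ fun _ => hρ.mul_right _
    · exact integrable_const _
    · refine ae_of_all _ fun z => ?_
      have := (hg _ (abs_le.1 (hmem z))).mul_right (f z)
      simpa only [hF, mul_assoc] using this
  obtain ⟨h1, h2⟩ := integral_inner_pow_mul hζ hf x
  -- Only the exponents `k + 2j` contribute, so the sum is reindexed along them.
  have hinj : Function.Injective fun j : ℕ => k + 2 * j := fun i j h => by simpa using h
  rw [← hinj.hasSum_iff] at hsum
  · have hF1 : ((fun m => ∫ z, F m z ∂(unifSph ζ)) ∘ fun j => k + 2 * j) =
        fun j => ρ (k + 2 * j) * powCoeff ζ k j * f x := by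
      funext j
      simp only [Function.comp_apply, hF, integral_const_mul, h1, mul_assoc]
    rw [hF1] at hsum
    exact hsum.unique ((summable_mul_powCoeff hζ h0 hρ k).hasSum.mul_right (f x))
  · intro m hm
    simp only [hF, integral_const_mul]
    rw [h2 m fun j hj => hm ⟨j, hj.symm⟩, mul_zero]

end Multisphere

end

noncomputable section

namespace Multisphere

open Filter Topology Real Set

/-! ### Multivariate power series -/

/-- If the earlier coefficients vanish, dividing by `t ^ m` bounds `|a m|` by `t` times the absolute
sum of the tail; let `t` tend to `0` from the right. -/
lemma eq_zero_of_tsum_mul_pow_eq_zero {a : ℕ → ℝ} (ha : Summable a)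
    (h : ∀ t ∈ Icc (-1 : ℝ) 1, ∑' m, a m * t ^ m = 0) (m : ℕ) : a m = 0 := by
  induction m using Nat.strong_induction_on with
  | _ m ih =>
  set S : ℝ := ∑' j, |a (j + (m + 1))| with hS
  have habs : Summable fun j => |a (j + (m + 1))| := 
    (summable_nat_add_iff (f := fun j => |a j|) (m + 1)).2 ha.abs
  have key : ∀ t ∈ Ioc (0 : ℝ) 1, |a m| ≤ t * S := by
    intro t ht
    have htm : ∀ j : ℕ, |t ^ j| ≤ 1 := fun j => by
      rw [abs_of_nonneg (pow_nonneg ht.1.le _)]; exact pow_le_one₀ ht.1.le ht.2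
    have hsum : Summable fun j => a j * t ^ j :=
      Summable.of_norm_bounded ha.abs fun j => by
        rw [norm_mul, Real.norm_eq_abs, Real.norm_eq_abs]
        exact mul_le_of_le_one_right (abs_nonneg _) (htm j)
    have h1 := hsum.sum_add_tsum_nat_add (m + 1)
    rw [h t ⟨by linarith [ht.1], ht.2⟩, Finset.sum_range_succ, Finset.sum_eq_zero fun j hj => by
      rw [ih j (Finset.mem_range.1 hj), zero_mul], zero_add] at h1
    have h2 : ∑' j, a (j + (m + 1)) * t ^ (j + (m + 1)) =
        t ^ m * (t * ∑' j, a (j + (m + 1)) * t ^ j) := by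
      rw [← tsum_mul_left, ← tsum_mul_left]
      exact tsum_congr fun j => by ring
    have h3 : t ^ m * (a m + t * ∑' j, a (j + (m + 1)) * t ^ j) = 0 := by
      rw [mul_add, ← h2, mul_comm (t ^ m)]; exact h1
    have h4 := (mul_eq_zero.1 h3).resolve_left (pow_pos ht.1 m).ne'
    rw [eq_neg_of_add_eq_zero_left h4, abs_neg, abs_mul, abs_of_pos ht.1]
    refine mul_le_mul_of_nonneg_left ?_ ht.1.le
    have := tsum_of_norm_bounded (f := fun j => a (j + (m + 1)) * t ^ j) habs.hasSum fun j => by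
        rw [norm_mul, Real.norm_eq_abs, Real.norm_eq_abs]
        exact mul_le_of_le_one_right (abs_nonneg _) (htm j)
    simpa using this
  have hlim : Tendsto (fun t : ℝ => t * S) (𝓝[>] 0) (𝓝 0) := by
    have : Tendsto (fun t : ℝ => t * S) (𝓝 0) (𝓝 (0 * S)) := tendsto_id.mul_const S
    rw [zero_mul] at this
    exact this.mono_left nhdsWithin_le_nhds
  have hle : |a m| ≤ 0 := ge_of_tendsto hlim (by
    filter_upwards [Ioc_mem_nhdsGT (zero_lt_one' ℝ)] with t ht using key t ht)
  exact abs_nonpos_iff.1 hle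

lemma summable_mul_prod_pow {d : ℕ} {e : (Fin d → ℕ) → ℝ} (he : Summable e) {t : Fin d → ℝ}
    (ht : ∀ i, t i ∈ Icc (-1 : ℝ) 1) : Summable fun n => e n * ∏ i, t i ^ n i :=
  Summable.of_norm_bounded he.abs fun n => by
    rw [norm_mul, Real.norm_eq_abs, Real.norm_eq_abs, Finset.abs_prod]
    refine mul_le_of_le_one_right (abs_nonneg _) (Finset.prod_le_one (fun i _ => abs_nonneg _) ?_)
    intro i _
    rw [abs_pow]
    exact pow_le_one₀ (abs_nonneg _) (abs_le.2 (ht i))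

/-- Induction on the number of variables, reading the series as a power series in the first one with
coefficients that are series in the others. -/
lemma eq_zero_of_tsum_mul_prod_pow_eq_zero {d : ℕ} {e : (Fin d → ℕ) → ℝ} (he : Summable e)
    (h : ∀ t : Fin d → ℝ, (∀ i, t i ∈ Icc (-1 : ℝ) 1) → ∑' n, e n * ∏ i, t i ^ n i = 0) :
    e = 0 := by
  induction d with
  | zero =>
    have := h (fun _ => 0) (fun i => i.elim0)
    funext n
    rw [tsum_eq_single default fun m hm => absurd (Subsingleton.elim m default) hm] at this
    rw [Subsingleton.elim n default]
    simpa using this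
  | succ d ih =>
    let φ := Fin.consEquiv (fun _ : Fin (d + 1) => ℕ)
    have heφ : Summable fun p : ℕ × (Fin d → ℕ) => e (φ p) := φ.summable_iff.2 he
    have key : ∀ m, (fun n' : Fin d → ℕ => e (φ (m, n'))) = 0 := by
      intro m
      refine ih (heφ.prod_factor m) fun t' ht' => ?_
      have hsum : Summable fun p : ℕ × (Fin d → ℕ) => e (φ p) * ∏ i, t' i ^ p.2 i := by
        refine Summable.of_norm_bounded heφ.abs fun p => ?_
        rw [norm_mul, Real.norm_eq_abs, Real.norm_eq_abs, Finset.abs_prod]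
        refine mul_le_of_le_one_right (abs_nonneg _)
          (Finset.prod_le_one (fun i _ => abs_nonneg _) fun i _ => ?_)
        rw [abs_pow]
        exact pow_le_one₀ (abs_nonneg _) (abs_le.2 (ht' i))
      refine eq_zero_of_tsum_mul_pow_eq_zero hsum.prod (fun t ht => ?_) m
      have h1 := h (Fin.cons t t') fun i => by
        refine Fin.cases ?_ (fun j => ?_) i
        · simpa using ht
        · simpa using ht' j
      have hall : Summable fun n : Fin (d + 1) → ℕ =>
          e n * ∏ i, (Fin.cons t t' : Fin (d + 1) → ℝ) i ^ n i :=
        summable_mul_prod_pow he fun i => by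
          refine Fin.cases ?_ (fun j => ?_) i
          · simpa using ht
          · simpa using ht' j
      have hall' := hall.comp_injective φ.injective
      simp only [Function.comp_def] at hall'
      rw [← φ.tsum_eq, hall'.tsum_prod] at h1
      rw [← h1]
      refine tsum_congr fun m' => ?_
      rw [← tsum_mul_right]
      refine tsum_congr fun n' => ?_
      simp only [φ, Fin.consEquiv_apply, Fin.prod_univ_succ, Fin.cons_zero, Fin.cons_succ]
      ring
    funext n
    have := congrFun (key (φ.symm n).1) (φ.symm n).2
    simpa using this

lemma hasSum_prod_apply {d : ℕ} {f : Fin d → ℕ → ℝ} {s : Fin d → ℝ} (h : ∀ i, HasSum (f i) (s i)) :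
    HasSum (fun n : Fin d → ℕ => ∏ i, f i (n i)) (∏ i, s i) := by
  induction d with
  | zero => simp
  | succ d ih =>
    let φ := Fin.consEquiv (fun _ : Fin (d + 1) => ℕ)
    have h2 := ih fun i => h i.succ
    have hmul : ∀ (g : (Fin d → ℕ) → ℝ) (r : ℝ), HasSum g r →
        HasSum (fun p : ℕ × (Fin d → ℕ) => f 0 p.1 * g p.2) (s 0 * r) := fun g r hg =>
      (h 0).mul hg (summable_mul_of_summable_norm (summable_norm_iff.2 (h 0).summable)
        (summable_norm_iff.2 hg.summable))
    have h3 := hmul _ _ h2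
    rw [← φ.hasSum_iff, Fin.prod_univ_succ]
    convert! h3 using 1
    funext p
    simp [φ, Fin.consEquiv_apply, Fin.prod_univ_succ]

/-- A product of functions of one variable each that is given by a power series with nonnegative
coefficients is, up to a constant, a product of such power series. -/
theorem exists_factorization {d : ℕ} {κ : Fin d → ℝ → ℝ} {b : (Fin d → ℕ) → ℝ} (hb : ∀ n, 0 ≤ b n)
    (hne : b ≠ 0)
    (hsum : ∀ t : Fin d → ℝ, (∀ i, t i ∈ Icc (-1 : ℝ) 1) →
      HasSum (fun n => b n * ∏ i, t i ^ n i) (∏ i, κ i (t i))) :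
    0 < ∏ i, κ i 1 ∧ ∃ ρ : Fin d → ℕ → ℝ, (∀ i m, 0 ≤ ρ i m) ∧
      (∀ i, ∀ t ∈ Icc (-1 : ℝ) 1, HasSum (fun m => ρ i m * t ^ m) (κ i t / κ i 1)) ∧
      (∀ n, b n = (∏ i, κ i 1) * ∏ i, ρ i (n i)) ∧
      ∀ i m, (∀ n, n i = m → b n = 0) → ρ i m = 0 := by
  have hone : (1 : ℝ) ∈ Icc (-1 : ℝ) 1 := by norm_num
  have hbsum : HasSum b (∏ i, κ i 1) := by simpa using hsum (fun _ => 1) fun _ => hone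
  obtain ⟨n₀, hn₀⟩ := Function.ne_iff.1 hne
  have hA : 0 < ∏ i, κ i 1 := by
    rw [← hbsum.tsum_eq]
    exact hbsum.summable.tsum_pos hb n₀ ((hb n₀).lt_of_ne' hn₀)
  have hκ : ∀ i, κ i 1 ≠ 0 := fun i => Finset.prod_ne_zero_iff.1 hA.ne' i (Finset.mem_univ i)
  set A := ∏ i, κ i 1 with hA_def
  -- Setting all variables but the `i`-th to `1` leaves a one-variable series whose coefficients are
  -- these marginal sums of `b`.
  set ρ : Fin d → ℕ → ℝ := fun i m => A⁻¹ * ∑' n : {n : Fin d → ℕ // n i = m}, b n with hρ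
  have hρsum : ∀ i, ∀ t ∈ Icc (-1 : ℝ) 1, HasSum (fun m => ρ i m * t ^ m) (κ i t / κ i 1) := by
    intro i t ht
    have h1 := hsum (Function.update (fun _ => 1) i t) fun l => by
      by_cases hl : l = i
      · subst hl; simpa using ht
      · simp [Function.update_of_ne hl]
    have e1 : ∀ n : Fin d → ℕ,
        ∏ l, Function.update (fun _ : Fin d => (1 : ℝ)) i t l ^ n l = t ^ n i := fun n => by
      rw [Finset.prod_eq_single i (fun l _ hl => by simp [Function.update_of_ne hl]) (by simp)]
      simp
    have e2 : ∏ l, κ l (Function.update (fun _ : Fin d => (1 : ℝ)) i t l) = A * (κ i t / κ i 1) := by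
      rw [hA_def, ← Finset.mul_prod_erase _ _ (Finset.mem_univ i),
        ← Finset.mul_prod_erase _ (fun l => κ l 1) (Finset.mem_univ i), Function.update_self,
        Finset.prod_congr rfl fun l hl => by rw [Function.update_of_ne (Finset.ne_of_mem_erase hl)]]
      have := hκ i
      field_simp
    simp only [e1, e2] at h1
    rw [← (Equiv.sigmaFiberEquiv fun n : Fin d → ℕ => n i).hasSum_iff] at h1
    have h2 := h1.sigma (g := fun m => (∑' n : {n : Fin d → ℕ // n i = m}, b n) * t ^ m) fun m => by
      have h3 := ((hbsum.summable.subtype {n | n i = m}).hasSum).mul_right (t ^ m)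
      convert! h3 using 1
      funext n
      have : n.1 i = m := n.2
      simp [Equiv.sigmaFiberEquiv, this]
    have h4 := h2.mul_left A⁻¹
    rw [inv_mul_cancel_left₀ hA.ne'] at h4
    simpa only [hρ, mul_assoc] using h4
  refine ⟨hA, ρ, fun i m => mul_nonneg (inv_nonneg.2 hA.le) (tsum_nonneg fun n => hb n), hρsum,
    fun n => ?_, fun i m h => ?_⟩
  · have hprod : HasSum (fun n : Fin d → ℕ => A * ∏ i, ρ i (n i)) (A * ∏ i, (κ i 1 / κ i 1)) :=
      (hasSum_prod_apply fun i => by simpa using hρsum i 1 hone).mul_left A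
    -- Both families are summable and give the same function on the cube, so uniqueness of
    -- coefficients identifies them.
    have hdiff : (fun n => b n - A * ∏ i, ρ i (n i)) = 0 := by
      refine eq_zero_of_tsum_mul_prod_pow_eq_zero (hbsum.summable.sub hprod.summable)
        fun t ht => ?_
      have h1 := hsum t ht
      have h2 := (hasSum_prod_apply fun i => hρsum i (t i) (ht i)).mul_left A
      have e : A * ∏ i, (κ i (t i) / κ i 1) = ∏ i, κ i (t i) := by
        rw [Finset.prod_div_distrib, ← hA_def]
        field_simp
      rw [e] at h2
      have h3 := h1.sub h2
      rw [sub_self] at h3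
      rw [← h3.tsum_eq]
      refine tsum_congr fun n => ?_
      rw [sub_mul, mul_assoc, ← Finset.prod_mul_distrib]
    exact sub_eq_zero.1 (congrFun hdiff n)
  · simp only [hρ]
    rw [show (∑' n : {n : Fin d → ℕ // n i = m}, b n) = 0 from ?_, mul_zero]
    exact (tsum_congr fun n : {n : Fin d → ℕ // n i = m} => h n.1 n.2).trans tsum_zero

/-! ### Separating joint limits -/

/-- Nothing is known about `g`, but for a frozen second index its logarithm cancels in differences,
so `log f` is Cauchy. Nonnegativity of `f` fixes the sign that the real logarithm forgets. -/
lemma exists_tendsto_of_tendsto_mul {f g : ℕ → ℝ} (hf : ∀ m, 0 ≤ f m) {L : ℝ}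
    (hL : 0 < L) (h : Tendsto (fun p : ℕ × ℕ => f p.1 * g p.2) (atTop ×ˢ atTop) (𝓝 L)) :
    ∃ l, 0 < l ∧ Tendsto f atTop (𝓝 l) := by
  have hlog := ((continuousAt_log hL.ne').tendsto.comp h)
  have hpos : ∀ᶠ p : ℕ × ℕ in atTop ×ˢ atTop, 0 < f p.1 * g p.2 := h.eventually_const_lt hL
  have hC : ∀ ε > 0, ∃ N, ∀ m ≥ N, ∀ m' ≥ N,
      0 < f m * g m' ∧ |log (f m * g m') - log L| < ε := by
    intro ε hε
    have h1 := hpos.and (Metric.tendsto_nhds.1 hlog ε hε)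
    rw [prod_atTop_atTop_eq, eventually_atTop] at h1
    obtain ⟨⟨N, N'⟩, hN⟩ := h1
    exact ⟨max N N', fun m hm m' hm' => hN (m, m')
      ⟨(le_max_left _ _).trans hm, (le_max_right _ _).trans hm'⟩⟩
  have hcauchy : CauchySeq fun m => log (f m) := by
    rw [Metric.cauchySeq_iff]
    intro ε hε
    obtain ⟨N, hN⟩ := hC (ε / 2) (by positivity)
    refine ⟨N, fun m hm n hn => ?_⟩
    obtain ⟨p1, h1⟩ := hN m hm N le_rfl
    obtain ⟨p2, h2⟩ := hN n hn N le_rfl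
    rw [log_mul (left_ne_zero_of_mul p1.ne') (right_ne_zero_of_mul p1.ne')] at h1
    rw [log_mul (left_ne_zero_of_mul p2.ne') (right_ne_zero_of_mul p2.ne')] at h2
    rw [Real.dist_eq, abs_lt]
    rw [abs_lt] at h1 h2
    constructor <;> linarith [h1.1, h1.2, h2.1, h2.2]
  obtain ⟨l, hl⟩ := cauchySeq_tendsto_of_complete hcauchy
  refine ⟨exp l, exp_pos l, ((continuous_exp.tendsto l).comp hl).congr' ?_⟩
  obtain ⟨N, hN⟩ := hC 1 one_pos
  filter_upwards [eventually_ge_atTop N] with m hm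
  have := left_ne_zero_of_mul (hN m hm N le_rfl).1.ne'
  exact exp_log ((hf m).lt_of_ne' this)

variable {d : ℕ}

lemma tendsto_atTopOn_iff {ι : Type*} {l : Filter ι} {S : Finset (Fin d)} {φ : ι → Fin d → ℕ} :
    Tendsto φ l (atTopOn S) ↔
      (∀ i ∈ S, Tendsto (fun a => φ a i) l atTop) ∧ ∀ᶠ a in l, ∀ i ∉ S, φ a i = 0 := by
  simp only [atTopOn, tendsto_inf, tendsto_iInf, tendsto_comap_iff, tendsto_principal,
    Function.comp_def, mem_ofPred_eq]

lemma eventually_atTopOn_pos (S : Finset (Fin d)) :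
    ∀ᶠ n in atTopOn S, (∀ i ∈ S, 0 < n i) ∧ ∀ i ∉ S, n i = 0 := by
  have h := (tendsto_atTopOn_iff (S := S) (l := atTopOn S) (φ := id)).1 tendsto_id
  refine Eventually.and ?_ h.2
  rw [Filter.eventually_all_finset]
  exact fun i hi => (h.1 i hi).eventually_gt_atTop 0

lemma powProd_pos (R : Finset (Fin d)) (a : ℝ) (n : Fin d → ℕ) : 0 < powProd R a n :=
  Finset.prod_pos fun i hi => by
    have : (0 : ℝ) < n i := by exact_mod_cast (Finset.mem_filter.1 hi).2
    positivity

lemma powProd_eq (R : Finset (Fin d)) (a : ℝ) (n : Fin d → ℕ) :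
    powProd R a n = ∏ i ∈ R, if 0 < n i then (n i : ℝ) ^ (-a) else 1 := by
  rw [powProd, Finset.prod_filter]

lemma atTopOn_neBot (S : Finset (Fin d)) : (atTopOn S).NeBot := by
  have : Tendsto (fun (N : ℕ) (i : Fin d) => if i ∈ S then N else 0) atTop (atTopOn S) :=
    tendsto_atTopOn_iff.2 ⟨fun i hi => by simpa only [hi, if_true] using! tendsto_id,
      Eventually.of_forall fun N i hi => by simp [hi]⟩
  exact this.neBot

/-- The factors of a multi-index sequence with power decay have power decay themselves. -/
theorem exists_isEquivalent_factor {R : Finset (Fin d)} {b : (Fin d → ℕ) → ℝ} {c ν A : ℝ}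
    (hc : 0 < c) (hA : 0 < A) {ρ : Fin d → ℕ → ℝ} (h0 : ∀ i m, 0 ≤ ρ i m)
    (hρ : ∀ i ∉ R, ρ i 0 = 1) (hb : ∀ n, b n = A * ∏ i, ρ i (n i))
    (hasymp : b ~[atTopOn R] fun n => c * powProd R ν n) {i : Fin d} (hi : i ∈ R) :
    ∃ l, 0 < l ∧ ρ i ~[atTop] fun m : ℕ => l * (m : ℝ) ^ (-ν) := by
  have h1 := (Asymptotics.isEquivalent_iff_tendsto_one
    (Eventually.of_forall fun n => (mul_pos hc (powProd_pos R ν n)).ne')).1 hasymp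
  set f : Fin d → ℕ → ℝ := fun j m => ρ j m * (m : ℝ) ^ ν with hf
  have h2 : Tendsto (fun n : Fin d → ℕ => ∏ j ∈ R, f j (n j)) (atTopOn R) (𝓝 (c / A)) := by
    have h3 := h1.const_mul (c / A)
    rw [mul_one] at h3
    refine h3.congr' ?_
    filter_upwards [eventually_atTopOn_pos R] with n hn
    have e1 : b n = A * ∏ j ∈ R, ρ j (n j) := by
      rw [hb, Finset.prod_subset (Finset.subset_univ R) fun j _ hj => by rw [hn.2 j hj, hρ j hj]]
    have e2 : ∏ j ∈ R, f j (n j) = (∏ j ∈ R, ρ j (n j)) / powProd R ν n := by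
      rw [powProd_eq, ← Finset.prod_div_distrib]
      refine Finset.prod_congr rfl fun j hj => ?_
      rw [if_pos (hn.1 j hj), rpow_neg (Nat.cast_nonneg _), div_inv_eq_mul]
    rw [e2, Pi.div_apply, e1]
    have := (powProd_pos R ν n).ne'
    field_simp
  -- A two-parameter family suffices to isolate coordinate `i`: all other coordinates of `R` move
  -- together.
  let φ : ℕ × ℕ → Fin d → ℕ := fun p j => if j = i then p.1 else if j ∈ R then p.2 else 0
  have hφ : Tendsto φ (atTop ×ˢ atTop) (atTopOn R) := by
    refine tendsto_atTopOn_iff.2 ⟨fun j hj => ?_, Eventually.of_forall fun p j hj => ?_⟩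
    · by_cases hji : j = i
      · simpa [φ, hji] using tendsto_fst
      · simpa [φ, hji, hj] using tendsto_snd
    · have : j ≠ i := fun h => hj (h ▸ hi)
      simp [φ, this, hj]
  have h4 := h2.comp hφ
  have h5 : Tendsto (fun p : ℕ × ℕ => f i p.1 * ∏ j ∈ R.erase i, f j p.2) (atTop ×ˢ atTop)
      (𝓝 (c / A)) := by
    refine h4.congr fun p => ?_
    rw [Function.comp_apply, ← Finset.mul_prod_erase _ _ hi]
    congr 1
    · simp [φ]
    · refine Finset.prod_congr rfl fun j hj => ?_
      rw [Finset.mem_erase] at hj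
      simp [φ, hj.1, hj.2]
  obtain ⟨l, hl, hlim⟩ := exists_tendsto_of_tendsto_mul (f := f i) (g := fun m => ∏ j ∈ R.erase i, f j m)
    
    (fun m => mul_nonneg (h0 i m) (by positivity)) (div_pos hc hA) h5
  refine ⟨l, hl, ?_⟩
  have hne : ∀ᶠ m : ℕ in atTop, l * (m : ℝ) ^ (-ν) ≠ 0 := by
    filter_upwards [eventually_gt_atTop 0] with m hm
    have : (0 : ℝ) < m := by exact_mod_cast hm
    positivity
  rw [Asymptotics.isEquivalent_iff_tendsto_one hne]
  have h6 := hlim.mul_const l⁻¹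
  rw [mul_inv_cancel₀ hl.ne'] at h6
  refine h6.congr' ?_
  filter_upwards [eventually_gt_atTop 0] with m hm
  have : (0 : ℝ) < m := by exact_mod_cast hm
  simp only [hf, Pi.div_apply]
  rw [rpow_neg this.le]
  field_simp

end Multisphere

end

noncomputable section

namespace Multisphere

open Filter Topology Real Set

/-! ### The main theorem -/

variable {ζ d : ℕ}

/-- Two orthonormal vectors exist because `ζ ≥ 2`. Hence the series identity of the kernel holds on
the whole cube `[-1, 1]^d`. -/
lemma exists_inner_eq (hζ : 2 ≤ ζ) {t : ℝ} (ht : t ∈ Icc (-1 : ℝ) 1) :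
    ∃ x z : Sph ζ,
      inner ℝ (x : EuclideanSpace ℝ (Fin ζ)) (z : EuclideanSpace ℝ (Fin ζ)) = t := by
  let i₀ : Fin ζ := ⟨0, by omega⟩
  let i₁ : Fin ζ := ⟨1, by omega⟩
  have hne : i₀ ≠ i₁ := by simp [i₀, i₁]
  let e : EuclideanSpace ℝ (Fin ζ) := EuclideanSpace.single i₀ 1
  let e' : EuclideanSpace ℝ (Fin ζ) := EuclideanSpace.single i₁ 1
  have he : ‖e‖ = 1 := by simp [e]
  have he' : ‖e'‖ = 1 := by simp [e']
  have hee' : inner ℝ e e' = 0 := by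
    simp [e, e', EuclideanSpace.inner_single_left, hne]
  have h1 : 0 ≤ 1 - t ^ 2 := by nlinarith [ht.1, ht.2]
  have hz : ‖t • e + √(1 - t ^ 2) • e'‖ = 1 := by
    have : ‖t • e + √(1 - t ^ 2) • e'‖ ^ 2 = 1 := by
      rw [norm_add_sq_real, norm_smul, norm_smul, inner_smul_left, inner_smul_right, hee', he, he',
        mul_one, mul_one, Real.norm_eq_abs, Real.norm_eq_abs, sq_abs, sq_abs, sq_sqrt h1]
      simp
    exact (pow_eq_one_iff_of_nonneg (norm_nonneg _) two_ne_zero).1 this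
  refine ⟨⟨e, by simp [he]⟩, ⟨_, by simpa using hz⟩, ?_⟩
  simp only
  rw [inner_add_right, inner_smul_right, inner_smul_right, hee', real_inner_self_eq_norm_sq, he]
  simp

lemma exists_dots_eq (hζ : 2 ≤ ζ) {t : Fin d → ℝ} (ht : ∀ i, t i ∈ Icc (-1 : ℝ) 1) :
    ∃ x z : MS ζ d, dots x z = t := by
  choose x z h using fun i => exists_inner_eq hζ (ht i)
  exact ⟨x, z, funext h⟩

lemma isEquivalent_finset_prod {ι α : Type*} {l : Filter α} (S : Finset ι) {f g : ι → α → ℝ}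
    (h : ∀ i ∈ S, f i ~[l] g i) : (fun x => ∏ i ∈ S, f i x) ~[l] fun x => ∏ i ∈ S, g i x := by
  classical
  induction S using Finset.induction_on with
  | empty => simpa using Asymptotics.IsEquivalent.refl
  | insert i S hi ih =>
    simp only [Finset.prod_insert hi]
    exact (h i (Finset.mem_insert_self i S)).mul
      (ih fun j hj => h j (Finset.mem_insert_of_mem hj))

/-- The asymptotics of a product of positive sequences with power decay. -/
lemma exists_isEquivalent_prod {R S : Finset (Fin d)} (hSR : S ⊆ R) {A a : ℝ} (hA : 0 < A)
    {E : Fin d → ℕ → ℝ} (hpos : ∀ i ∉ S, 0 < E i 0)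
    (hE : ∀ i ∈ S, ∃ c, 0 < c ∧ E i ~[atTop] fun k : ℕ => c * (k : ℝ) ^ (-a)) :
    ∃ c', 0 < c' ∧ (fun k : Fin d → ℕ => A * ∏ i, E i (k i)) ~[atTopOn S]
      fun k => c' * powProd R a k := by
  choose! c hc hEc using hE
  -- Coordinates outside `S` stay at frequency `0` and enter the constant by their value there, so
  -- it depends on `S`.
  refine ⟨A * ((∏ i ∈ S, c i) * ∏ i ∈ Sᶜ, E i 0), mul_pos hA (mul_pos (Finset.prod_pos hc)
    (Finset.prod_pos fun i hi => hpos i (Finset.mem_compl.1 hi))), ?_⟩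
  have htend := ((tendsto_atTopOn_iff (S := S) (l := atTopOn S) (φ := id)).1 tendsto_id).1
  have h1 : (fun k : Fin d → ℕ => ∏ i ∈ S, E i (k i)) ~[atTopOn S]
      fun k => ∏ i ∈ S, c i * (k i : ℝ) ^ (-a) :=
    isEquivalent_finset_prod S fun i hi => (hEc i hi).comp_tendsto (htend i hi)
  have h2 := (Asymptotics.IsEquivalent.refl (l := atTopOn S)
    (u := fun _ : Fin d → ℕ => A * ∏ i ∈ Sᶜ, E i 0)).mul h1
  refine (h2.congr_left ?_).congr_right ?_
  · filter_upwards [eventually_atTopOn_pos S] with k hk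
    rw [Pi.mul_apply, ← Finset.prod_mul_prod_compl S, Finset.prod_congr rfl fun i hi => by
      rw [← hk.2 i (Finset.mem_compl.1 hi)]]
    ring
  · filter_upwards [eventually_atTopOn_pos S] with k hk
    have : powProd R a k = ∏ i ∈ S, (k i : ℝ) ^ (-a) := by
      rw [powProd_eq, ← Finset.prod_subset hSR fun i _ hi => by simp [hk.2 i hi]]
      exact Finset.prod_congr rfl fun i hi => if_pos (hk.1 i hi)
    rw [Pi.mul_apply, this, Finset.prod_mul_distrib]
    ring

/-- Uniform bounds for a product of positive sequences with power decay. -/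
lemma exists_bounds_prod {R : Finset (Fin d)} {A a : ℝ} (hA : 0 < A)
    {E : Fin d → ℕ → ℝ} (hone : ∀ i ∉ R, E i 0 = 1) (hpos : ∀ i ∈ R, ∀ k, 0 < E i k)
    (hE : ∀ i ∈ R, ∃ c, 0 < c ∧ E i ~[atTop] fun k : ℕ => c * (k : ℝ) ^ (-a)) :
    ∃ c₁ c₂ : ℝ, 0 < c₁ ∧ 0 < c₂ ∧ ∀ k : Fin d → ℕ, (∀ i ∉ R, k i = 0) →
      c₁ * powProd R a k ≤ A * ∏ i, E i (k i) ∧ A * ∏ i, E i (k i) ≤ c₂ * powProd R a k := by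
  have hbd : ∀ i ∈ R, ∃ c₁ c₂ : ℝ, 0 < c₁ ∧ 0 < c₂ ∧ ∀ k : ℕ,
      c₁ * (if 0 < k then (k : ℝ) ^ (-a) else 1) ≤ E i k ∧
        E i k ≤ c₂ * (if 0 < k then (k : ℝ) ^ (-a) else 1) := fun i hi => by
    obtain ⟨c, hc, h⟩ := hE i hi
    exact exists_bounds_of_isEquivalent (hpos i hi) hc h
  choose! c₁ c₂ hc₁ hc₂ hb using hbd
  refine ⟨A * ∏ i ∈ R, c₁ i, A * ∏ i ∈ R, c₂ i, mul_pos hA (Finset.prod_pos hc₁),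
    mul_pos hA (Finset.prod_pos hc₂), fun k hk => ?_⟩
  have e : ∏ i, E i (k i) = ∏ i ∈ R, E i (k i) :=
    (Finset.prod_subset (Finset.subset_univ R) fun i _ hi => by rw [hk i hi, hone i hi]).symm
  have hw : ∀ i, (0 : ℝ) ≤ if 0 < k i then (k i : ℝ) ^ (-a) else 1 := fun i => by
    split_ifs <;> positivity
  rw [e, powProd_eq, mul_assoc, mul_assoc, ← Finset.prod_mul_distrib, ← Finset.prod_mul_distrib]
  refine ⟨mul_le_mul_of_nonneg_left ?_ hA.le, mul_le_mul_of_nonneg_left ?_ hA.le⟩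
  · exact Finset.prod_le_prod (fun i hi => mul_nonneg (hc₁ i hi).le (hw i))
      fun i hi => (hb i hi (k i)).1
  · exact Finset.prod_le_prod (fun i hi => (hpos i hi _).le) fun i hi => (hb i hi (k i)).2

end Multisphere

end

theorem mainTheorem2 (ζ d : ℕ) (hζ : 2 ≤ ζ)
    (K : Multisphere.MS ζ d → Multisphere.MS ζ d → ℝ) (hK : Multisphere.IsFactorizable K)
    (b : (Fin d → ℕ) → ℝ) (hb : ∀ n, 0 ≤ b n) (hKb : Multisphere.HasPowerSeries K b)
    (R : Finset (Fin d)) (hR : R = Multisphere.receptiveField b)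
    (c ν : ℝ) (hc : 0 < c) (hν : 1 < ν) (hν' : ∀ m : ℤ, ν ≠ m)
    (hasymp : b ~[Multisphere.atTopOn R] fun n => c * Multisphere.powProd R ν n) :
    -- the SH-products form an orthonormal basis of `L²` with respect to the uniform measure
    (∀ Y, Multisphere.IsHarmonicSystem ζ Y →
      Orthonormal ℝ (fun p => ContinuousMap.toLp (E := ℝ) 2 (Multisphere.unif ζ d) ℝ
        (Multisphere.shProduct (d := d) Y p)) ∧
      (Submodule.span ℝ (Set.range fun p => ContinuousMap.toLp (E := ℝ) 2 (Multisphere.unif ζ d) ℝ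
        (Multisphere.shProduct (d := d) Y p))).topologicalClosure = ⊤) ∧
    ∃ lam : (Fin d → ℕ) → ℝ,
      -- every SH-product of frequencies `k` is an eigenfunction with eigenvalue `lam k`
      (∀ (k : Fin d → ℕ) (f : Fin d → C(Multisphere.Sph ζ, ℝ)),
        (∀ i, f i ∈ Multisphere.sphHarm ζ (k i)) → ∀ x,
          ∫ z, K x z * Multisphere.prodFun f z ∂(Multisphere.unif ζ d) =
            lam k * Multisphere.prodFun f x) ∧
      -- the asymptotics, for each set `S` of pixels with nonzero frequency
      (∀ S ⊆ R, ∃ c' : ℝ, 0 < c' ∧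
        lam ~[Multisphere.atTopOn S] fun k => c' * Multisphere.powProd R (ζ + 2 * ν - 3) k) ∧
      -- the rate holds up to constant factors uniformly over all frequencies in `R`
      (∃ c₁ c₂ : ℝ, 0 < c₁ ∧ 0 < c₂ ∧ ∀ k : Fin d → ℕ, (∀ i ∉ R, k i = 0) →
        c₁ * Multisphere.powProd R (ζ + 2 * ν - 3) k ≤ lam k ∧
          lam k ≤ c₂ * Multisphere.powProd R (ζ + 2 * ν - 3) k) ∧
      -- the eigenvalues vanish outside of the receptive field
      (∀ k : Fin d → ℕ, (∃ i ∉ R, 0 < k i) → lam k = 0) := by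
  open Multisphere in
  have hζ0 : 0 < ζ := by omega
  refine ⟨fun Y hY => ⟨shProduct_orthonormal hζ0 hY,
    span_toLp_shProduct_topologicalClosure hζ0 hY⟩, ?_⟩
  obtain ⟨κ, hκ⟩ := hK
  have hsum : ∀ t : Fin d → ℝ, (∀ i, t i ∈ Set.Icc (-1 : ℝ) 1) →
      HasSum (fun n => b n * ∏ i, t i ^ n i) (∏ i, κ i (t i)) := by
    intro t ht
    obtain ⟨x, z, rfl⟩ := exists_dots_eq hζ ht
    rw [← hκ x z]
    exact hKb x z
  -- The comparison function is positive and the filter is nontrivial, so `b` cannot vanish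
  -- identically.
  have hne : b ≠ 0 := by
    rintro rfl
    have := atTopOn_neBot R
    obtain ⟨n, hn⟩ := (Asymptotics.isEquivalent_zero_iff_eventually_zero.1 hasymp.symm).exists
    exact (mul_pos hc (powProd_pos R ν n)).ne' hn
  obtain ⟨hA, ρ, h0, hρ, hbρ, hρ0⟩ := exists_factorization hb hne hsum
  have hκ1 : ∀ i, κ i 1 ≠ 0 := fun i => Finset.prod_ne_zero_iff.1 hA.ne' i (Finset.mem_univ i)
  have hρs : ∀ i, HasSum (ρ i) 1 := fun i => by
    have := hρ i 1 (by norm_num)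
    simpa [hκ1 i] using this
  have hout : ∀ i ∉ R, ∀ m, 0 < m → ρ i m = 0 := fun i hi m hm => hρ0 i m fun n hn => by
    by_contra hbn
    refine hi (hR ▸ ?_)
    simp only [receptiveField, Finset.mem_filter, Finset.mem_univ, true_and]
    exact ⟨n, by omega, hbn⟩
  -- Each `ρ i` has total sum `1`, and here all the mass sits at `0`.
  have hout0 : ∀ i ∉ R, ρ i 0 = 1 := fun i hi =>
    (hasSum_single 0 fun m hm => hout i hi m (Nat.pos_of_ne_zero hm)).unique (hρs i)
  have hfac : ∀ i ∈ R, ∃ l, 0 < l ∧ ρ i ~[Filter.atTop] fun m : ℕ => l * (m : ℝ) ^ (-ν) :=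
    fun i hi => exists_isEquivalent_factor hc hA h0 hout0 hbρ hasymp hi
  have hE : ∀ i ∈ R, ∃ c', 0 < c' ∧
      eigenSum ζ (ρ i) ~[Filter.atTop] fun k : ℕ => c' * (k : ℝ) ^ (-(ζ + 2 * ν - 3)) :=
    fun i hi => by
      obtain ⟨l, hl, h⟩ := hfac i hi
      exact eigenSum_isEquivalent hζ hν hν' (h0 i) (hρs i).summable hl h
  have hEpos : ∀ i ∈ R, ∀ k, 0 < eigenSum ζ (ρ i) k := fun i hi k => by
    obtain ⟨l, hl, h⟩ := hfac i hi
    refine eigenSum_pos hζ (h0 i) (hρs i).summable ?_ k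
    -- Equivalence forces the comparison function to vanish wherever `ρ i` does, eventually; it is
    -- positive for `m > 0`.
    filter_upwards [Filter.eventually_gt_atTop 0, h.symm.isBigO.eq_zero_imp] with m hm hz
    refine (h0 i m).lt_of_ne' fun hzero => ?_
    have hm' : (0 : ℝ) < m := by exact_mod_cast hm
    exact (mul_pos hl (Real.rpow_pos_of_pos hm' _)).ne' (hz hzero)
  have hEone : ∀ i ∉ R, eigenSum ζ (ρ i) 0 = 1 := fun i hi => by
    rw [eigenSum_of_const hζ (hout i hi), if_pos rfl, hout0 i hi]
  refine ⟨fun k => (∏ i, κ i 1) * ∏ i, eigenSum ζ (ρ i) (k i), fun k f hf x => ?_,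
    fun S hS => ?_, ?_, ?_⟩
  · have hInt : ∀ i, ∫ z, κ i (inner ℝ (x i : EuclideanSpace ℝ (Fin ζ))
        (z : EuclideanSpace ℝ (Fin ζ))) * f i z ∂(unifSph ζ) =
        κ i 1 * (eigenSum ζ (ρ i) (k i) * f i (x i)) := fun i => by
      rw [← integral_kernel_mul hζ (h0 i) (hρs i).summable (hρ i) (hf i) (x i),
        ← integral_const_mul]
      congr 1; funext z
      have := hκ1 i
      field_simp
    calc ∫ z, K x z * prodFun f z ∂(unif ζ d)
        = ∫ z, ∏ i, κ i (inner ℝ (x i : EuclideanSpace ℝ (Fin ζ))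
            (z i : EuclideanSpace ℝ (Fin ζ))) * f i (z i) ∂(unif ζ d) := by
          congr 1; funext z
          rw [hκ, Finset.prod_mul_distrib]
          rfl
      _ = ∏ i, κ i 1 * (eigenSum ζ (ρ i) (k i) * f i (x i)) := by
          rw [integral_prod_unif fun i z => κ i (inner ℝ (x i : EuclideanSpace ℝ (Fin ζ))
            (z : EuclideanSpace ℝ (Fin ζ))) * f i z]
          exact Finset.prod_congr rfl fun i _ => hInt i
      _ = _ := by
          rw [Finset.prod_mul_distrib, Finset.prod_mul_distrib, ← mul_assoc]
          rfl
  · refine exists_isEquivalent_prod hS hA (fun i _ => ?_) fun i hi => hE i (hS hi)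
    by_cases hi : i ∈ R
    · exact hEpos i hi 0
    · rw [hEone i hi]; exact one_pos
  · exact exists_bounds_prod hA hEone hEpos hE
  · rintro k ⟨i, hi, hki⟩
    refine mul_eq_zero_of_right _ (Finset.prod_eq_zero (Finset.mem_univ i) ?_)
    rw [eigenSum_of_const hζ (hout i hi), if_neg hki.ne']
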